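/- **Setting.** Let $\mathcal S$ be a (measurable) state space, $\mathcal A$ a set of $K\ge 1$ actions, $\gamma\in[0,1)$, $L>0$ and $M\ge 0$. A call $\mathtt{oracle}(s,a)$ returns, independently of everything else, a pair $(R,Z)$ of a reward $R\in[0,1]$ and a next state $Z$, with a law depending on $(s,a)$. At each state $s$ there is a Bellman operator $F_s:\mathbb R^K\to\mathbb R$, with $F_s(x)$ jointly measurable in $(s,x)$. We assume one of the following. * (Entropy regularization.) For some $\lambda>0$, every $F_s$ is the smooth maximum $x\mapsto\lambda\log\sum_a e^{x_a/\lambda}$ or the smooth minimum $x\mapsto-\lambda\log\sum_a e^{-x_a/\lambda}$, with $L=1/\lambda$ and $M=\lambda\log K$. It is the smooth maximum everywhere in an MDP; in a two-player game it depends on whose turn it is. * (General operators.) Every $F_s$ is differentiable, $\nabla F_s\ge 0$, $0<\|\nabla F_s\|_1\le 1$, $|F_s(0)|\le M$, and $|F_s(x)-F_s(y)-(x-y)^{\mathsf T}\nabla F_s(y)|\le L\|x-y\|_2^2$ for all $x,y$. There is exactly one bounded measurable value function $V$ with $V(s)=F_s(Q_s)$, where $Q_s(a)=\mathbb E[R+\gamma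 V(Z)]$ and $(R,Z)\sim\mathtt{oracle}(s,a)$. **Algorithm.** Put $C=\frac{1+M}{1-\gamma}$, $\kappa=\frac{1-\sqrt\gamma}{KL}$ and $N(\epsilon)=\Big\lceil\frac{18(1+M)^2}{(1-\gamma)^4(1-\sqrt\gamma)^2}\cdot\frac{\log(2K/\delta')}{\epsilon^2}\Big\rceil$, and let $\ell$ be a clipping level. (If the formula for $N(\epsilon)$ is negative, read it as $0$; if $\gamma=0$, read $\epsilon/\sqrt\gamma$ as $+\infty$.) * $\mathtt{estimateQ}(s,\epsilon)$: for each action $a$, draw $N(\epsilon)$ independent samples of $R+\gamma v$, where $(R,Z)\leftarrow\mathtt{oracle}(s,a)$ and $v\leftarrow\mathtt{sampleV}(Z,\epsilon/\sqrt\gamma)$; return their mean, clipped to $[\ell,C]$. * $\mathtt{sampleV}(s,\epsilon)$: if $\epsilon\ge C$, return $0$. Otherwise, if $\epsilon\ge\kappa$, return $F_s(\mathtt{estimateQ}(s,\epsilon))$. Otherwise let $\hat Q\leftarrow\mathtt{estimateQ}(s,\sqrt{\kappa\epsilon})$, draw an action $A\sim\nabla F_s(\hat Q)/\|\nabla F_s(\hat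 Q)\|_1$, let $(R,Z)\leftarrow\mathtt{oracle}(s,A)$ and $v\leftarrow\mathtt{sampleV}(Z,\epsilon/\sqrt\gamma)$, and return $F_s(\hat Q)-\hat Q^{\mathsf T}\nabla F_s(\hat Q)+(R+\gamma v)\|\nabla F_s(\hat Q)\|_1$. (For entropy regularization $\|\nabla F_s\|_1=1$.) * $\mathtt{SmoothCruiser}(s,\epsilon,\delta')$: return $\hat V(s)=F_s(\mathtt{estimateQ}(s,\epsilon))$. The clipping level is $\ell=0$, which is allowed if $F_s(0)\ge0$ for all $s$ (in particular in every entropy-regularized MDP) or if $Q_s(a)\ge 0$ for all $s,a$; or it is $\ell=-C$, which is always allowed. **Theorem.** The number $n(\epsilon,\delta')$ of oracle calls made by $\mathtt{SmoothCruiser}(s,\epsilon,\delta')$ is deterministic and depends only on $K,\gamma,L,M,\epsilon,\delta'$. For every problem as above, every state $s$, every $\epsilon>0$ and every $0<\delta'<2K$, $$\mathbb P\big(|\hat V(s)-V(s)|>\epsilon\big)\le\delta'\,n(\epsilon,\delta').$$ Moreover, for all $\epsilon,\delta>0$ there is a $\delta'=\delta'(\epsilon,\delta)>0$, depending only on $\epsilon,\delta$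 and $K,\gamma,L,M$, such that for every problem as above and every state $s$ the output of $\mathtt{SmoothCruiser}(s,\epsilon,\delta')$ satisfies $$\mathbb P\big(|\hat V(s)-V(s)|>\epsilon\big)\le\delta ,$$ and such that for every fixed $\delta>0$ and every $c>0$, $n(\epsilon,\delta'(\epsilon,\delta))=O(1/\epsilon^{4+c})$ as $\epsilon\to0^+$. -/

import Mathlib

open MeasureTheory ProbabilityTheory Filter Topology Asymptotics

universe u

noncomputable section

/-! ## The environment, its Bellman operators and its value function -/

/-- A discounted planning problem with `K` actions on an arbitrary measurable state space `S`,
up to its discount factor.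
* `oracle (s, a)` is the joint law of the pair `(R, Z)` (reward, next state) that a call of the
  generative model with parameters `(s, a)` returns; rewards lie in `[0, 1]`.
* `F s` is the Bellman operator at the state `s`, a differentiable function on `ℝ^K`. -/
structure Env (S : Type u) [MeasurableSpace S] (K : ℕ) where
  oracle : Kernel (S × Fin K) (ℝ × S)
  markov : IsMarkovKernel oracle
  reward_mem : ∀ p, ∀ᵐ o ∂(oracle p), o.1 ∈ Set.Icc (0 : ℝ) 1
  F : S → (Fin K → ℝ) → ℝ
  measurable_F : Measurable (fun p : S × (Fin K → ℝ) => F p.1 p.2)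
  differentiable_F : ∀ s, Differentiable ℝ (F s)

/-- `x ↦ lam * log (∑ a, exp (x a / lam))`. For `lam > 0` this is the smooth maximum, and with
`-lam` in place of `lam` it is the smooth minimum `x ↦ -lam * log (∑ a, exp (-x a / lam))`. -/
def logSumExp {K : ℕ} (lam : ℝ) (x : Fin K → ℝ) : ℝ :=
  lam * Real.log (∑ a, Real.exp (x a / lam))

namespace Env

variable {S : Type u} [MeasurableSpace S] {K : ℕ}

/-- The `a`-th entry of the gradient of `F s` at `x`. -/
def grad (E : Env S K) (s : S) (x : Fin K → ℝ) (a : Fin K) : ℝ :=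
  fderiv ℝ (E.F s) x (Pi.single a 1)

/-- The `ℓ¹`-norm of the gradient of `F s` at `x`. -/
def gradNorm (E : Env S K) (s : S) (x : Fin K → ℝ) : ℝ := ∑ a, |E.grad s x a|

/-- Entropy regularization with temperature `lam`: at each state, the Bellman operator is the
smooth maximum or the smooth minimum. In an MDP it is the smooth maximum everywhere, in a
two-player game the choice depends on whose turn it is. -/
def IsEntropic (E : Env S K) (lam : ℝ) : Prop :=
  ∀ s, E.F s = logSumExp lam ∨ E.F s = logSumExp (-lam)

/-- General smooth Bellman operators: nonnegative gradients, with `ℓ¹`-norm in `(0, 1]`,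
`L`-smoothness with respect to the Euclidean norm, and `|F s 0| ≤ M`
(differentiability is part of `Env`). -/
structure IsSmooth (E : Env S K) (L M : ℝ) : Prop where
  grad_nonneg : ∀ s x a, 0 ≤ E.grad s x a
  gradNorm_pos : ∀ s x, 0 < E.gradNorm s x
  gradNorm_le : ∀ s x, E.gradNorm s x ≤ 1
  smooth : ∀ s x y,
    |E.F s x - E.F s y - ∑ a, (x a - y a) * E.grad s y a| ≤ L * ∑ a, (x a - y a) ^ 2
  abs_zero_le : ∀ s, |E.F s 0| ≤ M

/-- `Q_s(a) = 𝔼[R + γ V(Z)]` with `(R, Z)` an output of the oracle at `(s, a)`. -/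
def qValue (E : Env S K) (γ : ℝ) (V : S → ℝ) (s : S) (a : Fin K) : ℝ :=
  ∫ o, (o.1 + γ * V o.2) ∂(E.oracle (s, a))

/-- `V` is the value function: the bounded measurable solution of `V(s) = F_s(Q_s)`. -/
structure IsValue (E : Env S K) (γ : ℝ) (V : S → ℝ) : Prop where
  measurable : Measurable V
  bounded : ∃ B, ∀ s, |V s| ≤ B
  bellman : ∀ s, V s = E.F s (E.qValue γ V s)

lemma measurable_grad (E : Env S K) (a : Fin K) :
    Measurable (fun p : S × (Fin K → ℝ) => E.grad p.1 p.2 a) := by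
  have hm : ∀ n : ℕ, Measurable (fun p : S × (Fin K → ℝ) =>
      ((n : ℝ) + 1) * (E.F p.1 (p.2 + ((n : ℝ) + 1)⁻¹ • Pi.single a (1 : ℝ)) - E.F p.1 p.2)) := by
    intro n
    have h1 : Measurable (fun p : S × (Fin K → ℝ) =>
        (p.1, p.2 + ((n : ℝ) + 1)⁻¹ • (Pi.single a (1 : ℝ) : Fin K → ℝ))) := by fun_prop
    exact ((E.measurable_F.comp h1).sub E.measurable_F).const_mul _
  refine measurable_of_tendsto_metrizable hm (tendsto_pi_nhds.2 fun p => ?_)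
  have hd : HasFDerivAt (E.F p.1) (fderiv ℝ (E.F p.1) p.2) p.2 :=
    (E.differentiable_F p.1 p.2).hasFDerivAt
  have hc : Tendsto (fun n : ℕ => ‖((n : ℝ) + 1)‖) atTop atTop := by
    refine tendsto_norm_atTop_atTop.comp ?_
    exact tendsto_atTop_add_const_right _ _ tendsto_natCast_atTop_atTop
  have := hd.lim (Pi.single a (1 : ℝ)) (c := fun n : ℕ => ((n : ℝ) + 1)) hc
  simpa [grad] using this

lemma measurable_gradNorm (E : Env S K) :
    Measurable (fun p : S × (Fin K → ℝ) => E.gradNorm p.1 p.2) := by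
  unfold gradNorm
  exact Finset.measurable_sum _ fun a _ => (E.measurable_grad a).abs

/-- The law of an action drawn from `∇F_s(x) / ‖∇F_s(x)‖₁`, as a kernel in `(s, x)`. For entropy
regularization the `ℓ¹`-norm is `1`, and the action is drawn from `∇F_s(x)`. -/
def draw (E : Env S K) : Kernel (S × (Fin K → ℝ)) (Fin K) where
  toFun p := ∑ a, ENNReal.ofReal (E.grad p.1 p.2 a / E.gradNorm p.1 p.2) • Measure.dirac a
  measurable' := by
    refine Measure.measurable_of_measurable_coe _ fun s _ => ?_
    simp only [Measure.coe_finsetSum, Finset.sum_apply, Measure.smul_apply, smul_eq_mul]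
    exact Finset.measurable_sum _ fun a _ =>
      ((E.measurable_grad a).div E.measurable_gradNorm).ennreal_ofReal.mul_const _

end Env

/-! ## The parameters of the algorithm -/

/-- The parameters that the learner knows: the number `K` of actions, the discount factor `γ`, the
smoothness constant `L`, and the bound `M` on `|F_s(0)|`. -/
structure Params where
  K : ℕ
  γ : ℝ
  L : ℝ
  M : ℝ
  K_pos : 0 < K
  γ_nonneg : 0 ≤ γ
  γ_lt_one : γ < 1
  L_pos : 0 < L
  M_nonneg : 0 ≤ M

namespace Params

/-- The a-priori bound `(1 + M) / (1 - γ)` on the values. -/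
def cap (P : Params) : ℝ := (1 + P.M) / (1 - P.γ)

/-- The threshold `κ = (1 - √γ) / (K L)`. -/
def kappa (P : Params) : ℝ := (1 - √P.γ) / (P.K * P.L)

/-- The number of samples per action. -/
def N (P : Params) (δ' ε : ℝ) : ℕ :=
  ⌈18 * (1 + P.M) ^ 2 / ((1 - P.γ) ^ 4 * (1 - √P.γ) ^ 2) * (Real.log (2 * P.K / δ') / ε ^ 2)⌉₊

/-- The accuracy `ε / √γ` of the recursive calls. For `γ = 0` it is infinite; it is replaced by
`cap` then, which is equivalent, as all accuracies `≥ cap` are treated in the same way. -/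
def relax (P : Params) (ε : ℝ) : ℝ := if P.γ = 0 then P.cap else ε / √P.γ

/-- A bound on the depth of the recursion; it serves only to show that the recursion ends. -/
def depth (P : Params) (ε : ℝ) : ℕ :=
  if ε < P.cap then ⌈Real.log (P.cap / ε) / Real.log (1 / √P.γ)⌉₊ + 1 else 0

lemma depth_lt (P : Params) {ε e : ℝ} (hε : 0 < ε) (hc : ε < P.cap) (he : ε ≤ e) :
    P.depth (P.relax e) < P.depth ε := by
  have hd : P.depth ε = ⌈Real.log (P.cap / ε) / Real.log (1 / √P.γ)⌉₊ + 1 := by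
    simp [depth, hc]
  rw [hd]
  by_cases h0 : P.γ = 0
  · simp [relax, depth, h0]
  have hγ : 0 < P.γ := lt_of_le_of_ne P.γ_nonneg (Ne.symm h0)
  have hs : 0 < √P.γ := Real.sqrt_pos.2 hγ
  have hs1 : √P.γ < 1 := by
    rw [Real.sqrt_lt' one_pos]; simpa using P.γ_lt_one
  have hr : P.relax e = e / √P.γ := by simp [relax, h0]
  rw [hr]
  unfold depth
  split_ifs with h
  · have hepos : 0 < e := hε.trans_le he
    have hcap : 0 < P.cap := hε.trans hc
    have ht : 0 < Real.log (1 / √P.γ) := Real.log_pos (by rw [lt_div_iff₀ hs]; simpa using hs1)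
    have h1 : Real.log (P.cap / (e / √P.γ)) + Real.log (1 / √P.γ) ≤ Real.log (P.cap / ε) := by
      rw [← Real.log_mul (by positivity) (by positivity)]
      refine Real.log_le_log (by positivity) ?_
      have : P.cap / (e / √P.γ) * (1 / √P.γ) = P.cap / e := by field_simp
      rw [this]
      gcongr
    have h2 : 0 < Real.log (P.cap / (e / √P.γ)) :=
      Real.log_pos (by rw [lt_div_iff₀ (by positivity)]; simpa using h)
    have h3 : Real.log (P.cap / (e / √P.γ)) / Real.log (1 / √P.γ) + 1
        ≤ Real.log (P.cap / ε) / Real.log (1 / √P.γ) := by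
      rw [div_add_one ht.ne']
      gcongr
    have h4 := Nat.ceil_mono h3
    rw [Nat.ceil_add_one (by positivity)] at h4
    omega
  · omega

lemma le_sqrt_kappa (P : Params) {ε : ℝ} (hε : 0 < ε) (h : ε < P.kappa) :
    ε ≤ √(P.kappa * ε) :=
  Real.le_sqrt_of_sq_le (by nlinarith)

end Params

/-! ## The algorithm

All procedures are kernels: they map their input to the joint law of their output and of the number
of oracle calls made on the way. -/

open Classical in
/-- Independent draws from the Markov kernels `κ i`, one for each `i` in a finite set. -/
def indepKernel {S X ι : Type*} [MeasurableSpace S] [MeasurableSpace X] [Fintype ι]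
    (κ : ι → Kernel S X) : Kernel S (ι → X) :=
  if h : ∀ i, IsMarkovKernel (κ i) then
    { toFun := fun s => Measure.pi fun i => κ i s
      measurable' := by
        have := h
        refine Measurable.measure_of_isPiSystem_of_isProbabilityMeasure generateFrom_pi.symm
          isPiSystem_pi ?_
        rintro _ ⟨t, ht, rfl⟩
        simp only [Measure.pi_pi]
        exact Finset.measurable_prod _ fun i _ =>
          Kernel.measurable_coe (κ i) (ht i (Set.mem_univ i)) }
  else 0

namespace Env

variable {S : Type u} [MeasurableSpace S] {K : ℕ}

/-- Call `(R, Z) ← oracle(s, a)`, then run the procedure `T` at `Z`, with output `v`; return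
`R + γ v`. The counter of `T` is increased by one for the oracle call. -/
def sampleQ (E : Env S K) (γ : ℝ) (T : Kernel S (ℝ × ℕ)) : Kernel (S × Fin K) (ℝ × ℕ) :=
  (E.oracle ⊗ₖ T.comap (fun p : (S × Fin K) × (ℝ × S) => p.2.2) (by fun_prop)).map
    fun p => (p.1.1 + γ * p.2.1, p.2.2 + 1)

variable (P : Params) (E : Env S P.K) (lo δ' : ℝ)

/-- `estimateQ(s, ε)`, where `T` is the procedure `sampleV(·, ε / √γ)` that it calls: for each
action `a`, average `N(ε)` independent samples of `R + γ v`, and clip the average to `[lo, cap]`.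
The original algorithm has `lo = 0`. -/
def estimateQ (T : Kernel S (ℝ × ℕ)) (ε : ℝ) : Kernel S ((Fin P.K → ℝ) × ℕ) :=
  (indepKernel fun i : Fin P.K × Fin (P.N δ' ε) =>
      (E.sampleQ P.γ T).comap (fun s => (s, i.1)) (by fun_prop)).map
    fun w => (fun a => min P.cap (max lo ((∑ k, (w (a, k)).1) / P.N δ' ε)), ∑ i, (w i).2)

/-- `sampleV(s, ε)`, for `ε > 0`. In the last case the output is
`F_s(Q̂) - Q̂ᵀ ∇F_s(Q̂) + (R + γ v) ‖∇F_s(Q̂)‖₁`; the last factor is `1` for entropy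
regularization. -/
def sampleV (ε : ℝ) : Kernel S (ℝ × ℕ) :=
  if _h : ε ≤ 0 ∨ P.cap ≤ ε then
    Kernel.const S (Measure.dirac (0, 0))
  else if _hκ : P.kappa ≤ ε then
    (Kernel.id ×ₖ estimateQ P E lo δ' (sampleV (P.relax ε)) ε).map
      fun p => (E.F p.1 p.2.1, p.2.2)
  else
    (((Kernel.id ×ₖ
          estimateQ P E lo δ' (sampleV (P.relax √(P.kappa * ε))) √(P.kappa * ε)) ⊗ₖ
        E.draw.comap (fun p : S × (S × ((Fin P.K → ℝ) × ℕ)) => (p.2.1, p.2.2.1))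
          (by fun_prop)) ⊗ₖ
      (E.sampleQ P.γ (sampleV (P.relax ε))).comap
        (fun p : S × ((S × ((Fin P.K → ℝ) × ℕ)) × Fin P.K) => (p.1, p.2.2)) (by fun_prop)).map
      fun p =>
        let s := p.1.1.1
        let Q := p.1.1.2.1
        (E.F s Q - ∑ a, Q a * E.grad s Q a + p.2.1 * E.gradNorm s Q, p.1.1.2.2 + p.2.2)
termination_by P.depth ε
decreasing_by
  · push Not at _h
    exact P.depth_lt _h.1 _h.2 le_rfl
  · push Not at _h _hκ
    exact P.depth_lt _h.1 _h.2 (P.le_sqrt_kappa _h.1 _hκ)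
  · push Not at _h
    exact P.depth_lt _h.1 _h.2 le_rfl

/-- `SmoothCruiser(s, ε, δ')`: the joint law of its output and of the number of oracle calls. -/
def smoothCruiser (ε : ℝ) : Kernel S (ℝ × ℕ) :=
  (Kernel.id ×ₖ estimateQ P E lo δ' (sampleV P E lo δ' (P.relax ε)) ε).map
    fun p => (E.F p.1 p.2.1, p.2.2)

/-- The problems covered: Bellman operators from entropy regularization with temperature `lam`,
where `L = 1 / lam` and `M = lam * log K`, or general smooth Bellman operators. -/
def Admissible : Prop :=
  (∃ lam : ℝ, 0 < lam ∧ P.L = 1 / lam ∧ P.M = lam * Real.log P.K ∧ E.IsEntropic lam) ∨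
    E.IsSmooth P.L P.M

/-- The lower clipping levels covered: the level `0` of the original algorithm when no operator is
negative at `0` (this includes every entropy-regularized MDP) or, more generally, when no `Q_s(a)`
is negative; and the level `-cap`, for every problem. Clipping at `0` is wrong when some `Q_s(a)`
is negative, which happens in entropy-regularized games. -/
def ClipLevel (V : S → ℝ) (lo : ℝ) : Prop :=
  (lo = 0 ∧ ((∀ s, 0 ≤ E.F s 0) ∨ ∀ s a, 0 ≤ E.qValue P.γ V s a)) ∨ lo = -P.cap

end Env

end

/-!
The Bellman operator is a `γ`-contraction of the bounded measurable functions, hence has a unique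
fixed point `V`.

If every call to `estimateQ` succeeds, the output of `sampleV s ε` has mean within `ε` of `V s`:
linearizing `F_s` at an estimate `Q̂` with error at most `√(κ ε)` costs at most
`L K κ ε = (1 - √γ) ε` by smoothness, while the linear part is sampled with bias at most
`γ ε / √γ = √γ ε`. The output is also bounded, so by Hoeffding's inequality one mean of `N ε`
samples is off by more than its tolerance with probability at most `δ' / K`. To make successes
certain, every bad estimate is replaced by the true value; this moves at most `δ'` of the mass of
the law for each call to `estimateQ`, hence at most `δ'` times the number of oracle calls overall.

With `x ε` the number of oracle calls of `sampleV`, up to constants and with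
`ℓ = log (2K / δ')`, the recursion reads
`x ε ≤ (ℓ / ε) x (√(κ ε) / √γ) + x (ε / √γ)`. It replaces the exponent `a` of `1 / ε` by
`1 + a / 2`, whose fixed point is `2`, and the factors `ℓ` of the successive square roots
accumulate only to an arbitrarily small power of `1 / δ'`. The topmost `N ε` costs another
`1 / ε ^ 2`.
-/

/-! ## Finite mixtures and the smooth maximum -/

section Mixture

variable {ι : Type*} [Fintype ι] {p : ι → ℝ}

lemma integral_sum_dirac [MeasurableSpace ι] [MeasurableSingletonClass ι]
    (hp : ∀ a, 0 ≤ p a) (f : ι → ℝ) :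
    ∫ x, f x ∂(∑ a, ENNReal.ofReal (p a) • Measure.dirac a) = ∑ a, p a * f a := by
  rw [integral_finsetSum_measure fun a _ =>
    (integrable_dirac (by simp)).smul_measure ENNReal.ofReal_ne_top]
  refine Finset.sum_congr rfl fun a _ => ?_
  rw [integral_smul_measure, integral_dirac, ENNReal.toReal_ofReal (hp a), smul_eq_mul]

lemma isProbabilityMeasure_sum_dirac [MeasurableSpace ι]
    (hp : ∀ a, 0 ≤ p a) (h1 : ∑ a, p a = 1) :
    IsProbabilityMeasure (∑ a, ENNReal.ofReal (p a) • Measure.dirac a) := by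
  constructor
  simp only [Measure.coe_finsetSum, Finset.sum_apply, Measure.smul_apply, smul_eq_mul,
    measure_univ, mul_one]
  rw [← ENNReal.ofReal_sum_of_nonneg fun a _ => hp a, h1, ENNReal.ofReal_one]

lemma exp_sum_mul_le_sum_mul_exp (hp : ∀ a, 0 ≤ p a) (h1 : ∑ a, p a = 1) (v : ι → ℝ) :
    Real.exp (∑ a, p a * v a) ≤ ∑ a, p a * Real.exp (v a) :=
  convexOn_exp.map_sum_le (fun a _ => hp a) h1 fun a _ => Set.mem_univ (v a)

lemma sum_mul_exp_le_exp (hp : ∀ a, 0 ≤ p a) (h1 : ∑ a, p a = 1) {v : ι → ℝ} {r : ℝ}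
    (hv : ∀ a, |v a| ≤ r) :
    ∑ a, p a * Real.exp (v a) ≤ Real.exp (∑ a, p a * v a + r ^ 2 / 2) := by
  let _ : MeasurableSpace ι := ⊤
  have := isProbabilityMeasure_sum_dirac hp h1
  -- Hoeffding's lemma for the random variable `v` on the probability space `(ι, p)`
  have hmgf := (hasSubgaussianMGF_of_mem_Icc
    (μ := ∑ a, ENNReal.ofReal (p a) • Measure.dirac a) (X := v) (a := -r) (b := r)
    Measurable.of_discrete.aemeasurable (.of_forall fun a => abs_le.1 (hv a))).mgf_le 1
  have hvar : (((‖r - -r‖₊ / 2) ^ 2 : NNReal) : ℝ) = r ^ 2 := by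
    push_cast
    rw [div_pow, Real.norm_eq_abs, sq_abs]
    ring
  simp only [mgf, one_mul, integral_sum_dirac hp, hvar, one_pow, mul_one] at hmgf
  calc ∑ a, p a * Real.exp (v a)
      = Real.exp (∑ a, p a * v a) * ∑ a, p a * Real.exp (v a - ∑ a, p a * v a) := by
        rw [Finset.mul_sum]
        refine Finset.sum_congr rfl fun a _ => ?_
        rw [Real.exp_sub]
        field_simp
    _ ≤ Real.exp (∑ a, p a * v a + r ^ 2 / 2) := by
        rw [Real.exp_add]
        gcongr

end Mixture

section LogSumExp

variable {K : ℕ}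

/-- The softmax distribution at temperature `lam`; it is the gradient of `logSumExp lam`. -/
noncomputable def softmax (lam : ℝ) (x : Fin K → ℝ) (a : Fin K) : ℝ :=
  Real.exp (x a / lam) / ∑ b, Real.exp (x b / lam)

lemma sum_exp_pos (hK : 0 < K) (x : Fin K → ℝ) : 0 < ∑ b, Real.exp (x b) :=
  Finset.sum_pos (fun _ _ => Real.exp_pos _) ⟨⟨0, hK⟩, Finset.mem_univ _⟩

lemma softmax_nonneg (lam : ℝ) (x : Fin K → ℝ) (a : Fin K) : 0 ≤ softmax lam x a := by
  unfold softmax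
  positivity

lemma sum_softmax (hK : 0 < K) (lam : ℝ) (x : Fin K → ℝ) : ∑ a, softmax lam x a = 1 := by
  unfold softmax
  rw [← Finset.sum_div, div_self (sum_exp_pos hK fun b => x b / lam).ne']

lemma logSumExp_zero (lam : ℝ) : logSumExp (K := K) lam 0 = lam * Real.log K := by
  simp [logSumExp]

lemma hasFDerivAt_logSumExp (hK : 0 < K) {lam : ℝ} (hl : lam ≠ 0) (x : Fin K → ℝ) :
    HasFDerivAt (logSumExp lam)
      (∑ a, softmax lam x a • ContinuousLinearMap.proj (R := ℝ) (φ := fun _ : Fin K => ℝ) a) x := by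
  have hexp (a : Fin K) : HasFDerivAt (fun y : Fin K → ℝ => Real.exp (y a / lam))
      (Real.exp (x a / lam) • (lam⁻¹ •
        ContinuousLinearMap.proj (R := ℝ) (φ := fun _ : Fin K => ℝ) a)) x := by
    simp_rw [div_eq_inv_mul]
    exact ((hasFDerivAt_apply a x).const_mul _).exp
  refine (((HasFDerivAt.fun_sum fun a _ => hexp a).log
    (sum_exp_pos hK fun b => x b / lam).ne').const_mul lam).congr_fderiv ?_
  rw [Finset.smul_sum, Finset.smul_sum]
  refine Finset.sum_congr rfl fun a _ => ?_
  rw [smul_smul, smul_smul, smul_smul, softmax]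
  congr 1
  field_simp

lemma logSumExp_sub_logSumExp (hK : 0 < K) (lam : ℝ) (x y : Fin K → ℝ) :
    logSumExp lam x - logSumExp lam y
      = lam * Real.log (∑ a, softmax lam y a * Real.exp ((x a - y a) / lam)) := by
  have hx := sum_exp_pos hK fun b => x b / lam
  have hy := sum_exp_pos hK fun b => y b / lam
  have hratio : ∑ a, softmax lam y a * Real.exp ((x a - y a) / lam)
      = (∑ b, Real.exp (x b / lam)) / ∑ b, Real.exp (y b / lam) := by
    rw [Finset.sum_div]
    refine Finset.sum_congr rfl fun a _ => ?_
    rw [softmax, sub_div, Real.exp_sub]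
    field_simp
  rw [hratio, Real.log_div hx.ne' hy.ne', mul_sub, logSumExp, logSumExp]

lemma abs_logSumExp_sub_le (hK : 0 < K) {lam : ℝ} (hl : lam ≠ 0) (x y : Fin K → ℝ) :
    |logSumExp lam x - logSumExp lam y - ∑ a, (x a - y a) * softmax lam y a| ≤
      1 / |lam| * ∑ a, (x a - y a) ^ 2 := by
  set v : Fin K → ℝ := fun a => (x a - y a) / lam with hv
  set m := ∑ a, softmax lam y a * v a with hm
  set W := ∑ a, v a ^ 2 with hW
  have hW0 : 0 ≤ W := Finset.sum_nonneg fun a _ => sq_nonneg _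
  have hvW (a) : |v a| ≤ √W :=
    Real.abs_le_sqrt (Finset.single_le_sum (f := fun a => v a ^ 2)
      (fun a _ => sq_nonneg _) (Finset.mem_univ a))
  have hlower := exp_sum_mul_le_sum_mul_exp (softmax_nonneg lam y) (sum_softmax hK lam y) v
  have hupper := sum_mul_exp_le_exp (softmax_nonneg lam y) (sum_softmax hK lam y) hvW
  rw [Real.sq_sqrt hW0] at hupper
  have hpos := (Real.exp_pos _).trans_le hlower
  rw [← Real.le_log_iff_exp_le hpos] at hlower
  rw [← Real.log_le_iff_le_exp hpos] at hupper
  have hlin : ∑ a, (x a - y a) * softmax lam y a = lam * m := by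
    rw [hm, Finset.mul_sum]
    refine Finset.sum_congr rfl fun a _ => ?_
    rw [hv]
    field_simp
  have hquad : 1 / |lam| * ∑ a, (x a - y a) ^ 2 = |lam| * W := by
    have := abs_pos.2 hl
    simp only [hW, hv, div_pow, ← Finset.sum_div]
    rw [← sq_abs lam]
    field_simp
  rw [logSumExp_sub_logSumExp hK, hlin, hquad, ← mul_sub, abs_mul]
  gcongr
  exact abs_le.2 ⟨by linarith, by linarith⟩

end LogSumExp

/-! ## Smooth Bellman operators -/

namespace Env

variable {S : Type u} [MeasurableSpace S] {K : ℕ} {E : Env S K} {L M : ℝ}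

lemma grad_eq_softmax (hK : 0 < K) {lam : ℝ} (hl : lam ≠ 0) {s : S} (h : E.F s = logSumExp lam)
    (x : Fin K → ℝ) : E.grad s x = softmax lam x := by
  ext a
  rw [grad, h, (hasFDerivAt_logSumExp hK hl x).fderiv]
  simp [Pi.single_apply]

lemma IsEntropic.isSmooth (hK : 0 < K) {lam : ℝ} (hl : 0 < lam) (h : E.IsEntropic lam) :
    E.IsSmooth (1 / lam) (lam * Real.log K) := by
  have hF (s : S) : ∃ l : ℝ, l ≠ 0 ∧ |l| = lam ∧ E.F s = logSumExp l := by
    rcases h s with hs | hs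
    · exact ⟨lam, hl.ne', abs_of_pos hl, hs⟩
    · exact ⟨-lam, neg_ne_zero.2 hl.ne', by rw [abs_neg, abs_of_pos hl], hs⟩
  have hnorm (s x) : E.gradNorm s x = 1 := by
    obtain ⟨l, hl0, -, hs⟩ := hF s
    rw [gradNorm, grad_eq_softmax hK hl0 hs, ← sum_softmax hK l x]
    exact Finset.sum_congr rfl fun a _ => abs_of_nonneg (softmax_nonneg l x a)
  constructor
  case grad_nonneg =>
    intro s x a
    obtain ⟨l, hl0, -, hs⟩ := hF s
    rw [grad_eq_softmax hK hl0 hs]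
    exact softmax_nonneg l x a
  case gradNorm_pos => exact fun s x => (hnorm s x).symm ▸ one_pos
  case gradNorm_le => exact fun s x => (hnorm s x).le
  case smooth =>
    intro s x y
    obtain ⟨l, hl0, hla, hs⟩ := hF s
    rw [grad_eq_softmax hK hl0 hs, hs, ← hla]
    exact abs_logSumExp_sub_le hK hl0 x y
  case abs_zero_le =>
    intro s
    obtain ⟨l, -, hla, hs⟩ := hF s
    rw [hs, logSumExp_zero, abs_mul, hla, abs_of_nonneg (Real.log_natCast_nonneg K)]

lemma Admissible.isSmooth {P : Params} {E : Env S P.K} (h : E.Admissible P) :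
    E.IsSmooth P.L P.M := by
  rcases h with ⟨lam, hl, hL, hM, hE⟩ | hE
  · rw [hL, hM]
    exact hE.isSmooth P.K_pos hl
  · exact hE

lemma exists_sub_eq_sum_mul_grad (E : Env S K) (s : S) (x y : Fin K → ℝ) :
    ∃ z, E.F s x - E.F s y = ∑ a, (x a - y a) * E.grad s z a := by
  obtain ⟨z, -, hz⟩ := domain_mvt (f := E.F s) (s := Set.univ) (x := y) (y := x)
    (fun w _ => (E.differentiable_F s w).hasFDerivAt.hasFDerivWithinAt) convex_univ
    (Set.mem_univ _) (Set.mem_univ _)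
  refine ⟨z, hz.trans ?_⟩
  conv_lhs => rw [pi_eq_sum_univ' (x - y)]
  simp only [map_sum, map_smul, Pi.sub_apply, smul_eq_mul, grad]

namespace IsSmooth

lemma gradNorm_eq (h : E.IsSmooth L M) (s : S) (x : Fin K → ℝ) :
    E.gradNorm s x = ∑ a, E.grad s x a :=
  Finset.sum_congr rfl fun a _ => abs_of_nonneg (h.grad_nonneg s x a)

lemma abs_sum_mul_grad_le (h : E.IsSmooth L M) (s : S) (x : Fin K → ℝ) {v : Fin K → ℝ} {b : ℝ}
    (hb : 0 ≤ b) (hv : ∀ a, |v a| ≤ b) : |∑ a, v a * E.grad s x a| ≤ b := by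
  calc |∑ a, v a * E.grad s x a| ≤ ∑ a, |v a * E.grad s x a| := Finset.abs_sum_le_sum_abs _ _
    _ ≤ ∑ a, b * E.grad s x a := Finset.sum_le_sum fun a _ => by
        rw [abs_mul, abs_of_nonneg (h.grad_nonneg s x a)]
        exact mul_le_mul_of_nonneg_right (hv a) (h.grad_nonneg s x a)
    _ = b * E.gradNorm s x := by rw [h.gradNorm_eq, Finset.mul_sum]
    _ ≤ b := mul_le_of_le_one_right hb (h.gradNorm_le s x)

lemma abs_F_sub_le (h : E.IsSmooth L M) (s : S) {x y : Fin K → ℝ} {b : ℝ} (hb : 0 ≤ b)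
    (hxy : ∀ a, |x a - y a| ≤ b) : |E.F s x - E.F s y| ≤ b := by
  obtain ⟨z, hz⟩ := E.exists_sub_eq_sum_mul_grad s x y
  rw [hz]
  exact h.abs_sum_mul_grad_le s z hb hxy

lemma abs_F_le (h : E.IsSmooth L M) (s : S) {x : Fin K → ℝ} {b : ℝ} (hb : 0 ≤ b)
    (hx : ∀ a, |x a| ≤ b) : |E.F s x| ≤ M + b := by
  calc |E.F s x| = |E.F s 0 + (E.F s x - E.F s 0)| := by rw [add_sub_cancel]
    _ ≤ |E.F s 0| + |E.F s x - E.F s 0| := abs_add_le _ _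
    _ ≤ M + b := add_le_add (h.abs_zero_le s) (h.abs_F_sub_le s hb (by simpa using hx))

lemma F_zero_le (h : E.IsSmooth L M) (s : S) {x : Fin K → ℝ} (hx : ∀ a, 0 ≤ x a) :
    E.F s 0 ≤ E.F s x := by
  obtain ⟨z, hz⟩ := E.exists_sub_eq_sum_mul_grad s x 0
  have hsum : 0 ≤ ∑ a, (x a - (0 : Fin K → ℝ) a) * E.grad s z a :=
    Finset.sum_nonneg fun a _ => mul_nonneg (by simpa using hx a) (h.grad_nonneg s z a)
  linarith

end IsSmooth

end Env

/-! ## The value function -/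

namespace Params

variable (P : Params)

lemma one_sub_pos : 0 < 1 - P.γ := sub_pos.2 P.γ_lt_one

lemma cap_eq : P.cap = 1 + P.M + P.γ * P.cap := by
  have := P.one_sub_pos
  unfold cap
  field_simp
  ring

lemma one_add_le_cap : 1 + P.M ≤ P.cap := by
  have := P.M_nonneg
  rw [cap, le_div_iff₀ P.one_sub_pos]
  nlinarith [P.γ_nonneg]

lemma one_le_cap : 1 ≤ P.cap := by linarith [P.one_add_le_cap, P.M_nonneg]

lemma cap_pos : 0 < P.cap := one_pos.trans_le P.one_le_cap

lemma tendsto_mul_pow (B : ℝ) : Tendsto (fun k : ℕ => B * P.γ ^ k) atTop (𝓝 0) := by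
  simpa using (tendsto_pow_atTop_nhds_zero_of_lt_one P.γ_nonneg P.γ_lt_one).const_mul B

end Params

namespace Env

variable {S : Type u} [MeasurableSpace S] {K : ℕ}

instance (E : Env S K) : IsMarkovKernel E.oracle := E.markov

section Measurability

variable (E : Env S K) {X : Type*} [MeasurableSpace X] {f : X → S} {g : X → Fin K → ℝ}

@[fun_prop]
lemma measurable_F_comp (hf : Measurable f) (hg : Measurable g) :
    Measurable fun x => E.F (f x) (g x) :=
  E.measurable_F.comp (hf.prodMk hg)

@[fun_prop]
lemma measurable_grad_comp (hf : Measurable f) (hg : Measurable g) (a : Fin K) :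
    Measurable fun x => E.grad (f x) (g x) a :=
  (E.measurable_grad a).comp (hf.prodMk hg)

@[fun_prop]
lemma measurable_gradNorm_comp (hf : Measurable f) (hg : Measurable g) :
    Measurable fun x => E.gradNorm (f x) (g x) :=
  E.measurable_gradNorm.comp (hf.prodMk hg)

end Measurability

section QValue

variable (E : Env S K) {γ : ℝ} {V W : S → ℝ} {B B' : ℝ}

lemma integrable_target (hV : Measurable V) (hB : ∀ s, |V s| ≤ B) (p : S × Fin K) :
    Integrable (fun o => o.1 + γ * V o.2) (E.oracle p) := by
  have hreward : Integrable (fun o => o.1) (E.oracle p) :=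
    Integrable.of_mem_Icc 0 1 measurable_fst.aemeasurable (E.reward_mem p)
  have hvalue : Integrable (fun o => V o.2) (E.oracle p) :=
    Integrable.of_bound (hV.comp measurable_snd).aestronglyMeasurable B (.of_forall fun o => hB o.2)
  exact hreward.add (hvalue.const_mul γ)

lemma abs_qValue_le (hγ : 0 ≤ γ) (hB : ∀ s, |V s| ≤ B) (s : S) (a : Fin K) :
    |E.qValue γ V s a| ≤ 1 + γ * B := by
  have hae : ∀ᵐ o ∂(E.oracle (s, a)), ‖o.1 + γ * V o.2‖ ≤ 1 + γ * B := by
    filter_upwards [E.reward_mem (s, a)] with o ho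
    calc ‖o.1 + γ * V o.2‖ ≤ |o.1| + |γ * V o.2| := abs_add_le _ _
      _ = o.1 + γ * |V o.2| := by rw [abs_mul, abs_of_nonneg hγ, abs_of_nonneg ho.1]
      _ ≤ 1 + γ * B := by
        gcongr
        exacts [ho.2, hB _]
  simpa [qValue] using norm_integral_le_of_norm_le_const hae

lemma qValue_nonneg (hγ : 0 ≤ γ) (hV : ∀ s, 0 ≤ V s) (s : S) (a : Fin K) :
    0 ≤ E.qValue γ V s a := by
  refine integral_nonneg_of_ae ?_
  filter_upwards [E.reward_mem (s, a)] with o ho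
  exact add_nonneg ho.1 (mul_nonneg hγ (hV _))

lemma abs_qValue_sub_le (hγ : 0 ≤ γ) (hV : Measurable V) (hB : ∀ s, |V s| ≤ B)
    (hW : Measurable W) (hB' : ∀ s, |W s| ≤ B') {d : ℝ} (hd : ∀ s, |V s - W s| ≤ d)
    (s : S) (a : Fin K) : |E.qValue γ V s a - E.qValue γ W s a| ≤ γ * d := by
  have hsub : E.qValue γ V s a - E.qValue γ W s a
      = ∫ o, γ * (V o.2 - W o.2) ∂(E.oracle (s, a)) := by
    rw [qValue, qValue, ← integral_sub (E.integrable_target hV hB (s, a))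
      (E.integrable_target hW hB' (s, a))]
    refine integral_congr_ae (.of_forall fun o => ?_)
    ring
  have hbound (o : ℝ × S) : ‖γ * (V o.2 - W o.2)‖ ≤ γ * d := by
    rw [Real.norm_eq_abs, abs_mul, abs_of_nonneg hγ]
    exact mul_le_mul_of_nonneg_left (hd _) hγ
  rw [hsub]
  simpa using norm_integral_le_of_norm_le_const (μ := E.oracle (s, a)) (.of_forall hbound)

lemma measurable_qValue (hV : Measurable V) : Measurable (E.qValue γ V) := by
  refine measurable_pi_lambda _ fun a => ?_
  have htarget : StronglyMeasurable fun o : ℝ × S => o.1 + γ * V o.2 :=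
    Measurable.stronglyMeasurable (by fun_prop)
  exact (htarget.integral_kernel (κ := E.oracle)).measurable.comp (by fun_prop)

end QValue

/-- The Bellman operator on functions of the state, whose fixed point is the value function. -/
noncomputable def bellman (E : Env S K) (γ : ℝ) (V : S → ℝ) (s : S) : ℝ := E.F s (E.qValue γ V s)

/-- Value iteration started at `0`, used to construct the value function and to bound it. -/
noncomputable def valueIter (E : Env S K) (γ : ℝ) (k : ℕ) : S → ℝ := (E.bellman γ)^[k] 0

lemma valueIter_zero (E : Env S K) (γ : ℝ) : E.valueIter γ 0 = 0 := rfl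

lemma valueIter_succ (E : Env S K) (γ : ℝ) (k : ℕ) :
    E.valueIter γ (k + 1) = E.bellman γ (E.valueIter γ k) :=
  Function.iterate_succ_apply' _ _ _

lemma measurable_valueIter (E : Env S K) (γ : ℝ) (k : ℕ) : Measurable (E.valueIter γ k) := by
  induction k with
  | zero => exact measurable_const
  | succ k ih =>
    rw [valueIter_succ]
    exact E.measurable_F_comp measurable_id (E.measurable_qValue ih)

lemma valueIter_nonneg {E : Env S K} {γ L M : ℝ} (h : E.IsSmooth L M) (hγ : 0 ≤ γ)
    (h0 : ∀ s, 0 ≤ E.F s 0) (k : ℕ) (s : S) : 0 ≤ E.valueIter γ k s := by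
  induction k generalizing s with
  | zero => exact le_rfl
  | succ k ih =>
    rw [valueIter_succ]
    exact (h0 s).trans (h.F_zero_le s (E.qValue_nonneg hγ ih s))

variable {P : Params} {E : Env S P.K} {V : S → ℝ}

lemma abs_bellman_sub_le (h : E.IsSmooth P.L P.M) {W : S → ℝ} {B B' : ℝ}
    (hV : Measurable V) (hB : ∀ s, |V s| ≤ B) (hW : Measurable W) (hB' : ∀ s, |W s| ≤ B') {d : ℝ}
    (hd : ∀ s, |V s - W s| ≤ d) (s : S) :
    |E.bellman P.γ V s - E.bellman P.γ W s| ≤ P.γ * d :=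
  h.abs_F_sub_le s (mul_nonneg P.γ_nonneg ((abs_nonneg _).trans (hd s)))
    (E.abs_qValue_sub_le P.γ_nonneg hV hB hW hB' hd s)

lemma abs_valueIter_le (h : E.IsSmooth P.L P.M) (k : ℕ) (s : S) :
    |E.valueIter P.γ k s| ≤ P.cap := by
  induction k generalizing s with
  | zero => simpa [valueIter_zero] using P.cap_pos.le
  | succ k ih =>
    have hcap : 0 ≤ 1 + P.γ * P.cap := by
      have := P.γ_nonneg
      have := P.cap_pos
      positivity
    have := h.abs_F_le s hcap (E.abs_qValue_le P.γ_nonneg ih s)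
    rw [valueIter_succ, P.cap_eq]
    exact this.trans_eq (by ring)

lemma abs_valueIter_sub_succ_le (h : E.IsSmooth P.L P.M) (k : ℕ) (s : S) :
    |E.valueIter P.γ k s - E.valueIter P.γ (k + 1) s| ≤ P.cap * P.γ ^ k := by
  induction k generalizing s with
  | zero => simpa [valueIter_zero] using abs_valueIter_le h 1 s
  | succ k ih =>
    have := abs_bellman_sub_le h (E.measurable_valueIter P.γ k) (abs_valueIter_le h k)
      (E.measurable_valueIter P.γ (k + 1)) (abs_valueIter_le h (k + 1)) ih s
    rw [valueIter_succ, E.valueIter_succ _ (k + 1)]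
    exact this.trans_eq (by ring)

lemma exists_isValue (h : E.IsSmooth P.L P.M) : ∃ V, E.IsValue P.γ V := by
  have hcauchy (s k) : dist (E.valueIter P.γ k s) (E.valueIter P.γ (k + 1) s) ≤ P.cap * P.γ ^ k :=
    abs_valueIter_sub_succ_le h k s
  choose V hV using fun s =>
    cauchySeq_tendsto_of_complete (cauchySeq_of_le_geometric _ _ P.γ_lt_one (hcauchy s))
  have hmeas : Measurable V :=
    measurable_of_tendsto_metrizable (E.measurable_valueIter P.γ) (tendsto_pi_nhds.2 hV)
  have hcap (s) : |V s| ≤ P.cap :=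
    le_of_tendsto' (hV s).abs fun k => abs_valueIter_le h k s
  have herror (k s) : |E.valueIter P.γ k s - V s| ≤ P.cap * P.γ ^ k / (1 - P.γ) :=
    dist_le_of_le_geometric_of_tendsto _ _ P.γ_lt_one (hcauchy s) (hV s) k
  refine ⟨V, hmeas, ⟨_, hcap⟩, fun s => ?_⟩
  have hzero : Tendsto (fun k => P.γ * (P.cap * P.γ ^ k / (1 - P.γ))) atTop (𝓝 0) := by
    simpa using ((P.tendsto_mul_pow P.cap).div_const (1 - P.γ)).const_mul P.γ
  have hfixed : Tendsto (fun k => E.valueIter P.γ (k + 1) s) atTop (𝓝 (E.bellman P.γ V s)) := by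
    simp only [valueIter_succ]
    rw [tendsto_iff_dist_tendsto_zero]
    exact squeeze_zero (fun _ => dist_nonneg) (fun k => abs_bellman_sub_le h
      (E.measurable_valueIter P.γ k) (abs_valueIter_le h k) hmeas hcap (herror k) s) hzero
  exact tendsto_nhds_unique ((tendsto_add_atTop_iff_nat 1).2 (hV s)) hfixed

namespace IsValue

lemma abs_valueIter_sub_le (h : E.IsSmooth P.L P.M) (hV : E.IsValue P.γ V) {B : ℝ}
    (hB : ∀ s, |V s| ≤ B) (k : ℕ) (s : S) : |E.valueIter P.γ k s - V s| ≤ B * P.γ ^ k := by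
  induction k generalizing s with
  | zero => simpa [valueIter_zero] using hB s
  | succ k ih =>
    have := abs_bellman_sub_le h (E.measurable_valueIter P.γ k) (abs_valueIter_le h k)
      hV.measurable hB ih s
    rw [valueIter_succ, hV.bellman s]
    exact this.trans_eq (by ring)

lemma tendsto_valueIter (h : E.IsSmooth P.L P.M) (hV : E.IsValue P.γ V) (s : S) :
    Tendsto (fun k => E.valueIter P.γ k s) atTop (𝓝 (V s)) := by
  obtain ⟨B, hB⟩ := hV.bounded
  rw [tendsto_iff_dist_tendsto_zero]
  exact squeeze_zero (fun _ => dist_nonneg) (fun k => hV.abs_valueIter_sub_le h hB k s)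
    (P.tendsto_mul_pow B)

lemma unique (h : E.IsSmooth P.L P.M) {W : S → ℝ} (hV : E.IsValue P.γ V)
    (hW : E.IsValue P.γ W) : V = W :=
  funext fun s => tendsto_nhds_unique (hV.tendsto_valueIter h s) (hW.tendsto_valueIter h s)

lemma abs_le_cap (h : E.IsSmooth P.L P.M) (hV : E.IsValue P.γ V) (s : S) : |V s| ≤ P.cap :=
  le_of_tendsto' (hV.tendsto_valueIter h s).abs fun k => abs_valueIter_le h k s

lemma nonneg (h : E.IsSmooth P.L P.M) (hV : E.IsValue P.γ V) (h0 : ∀ s, 0 ≤ E.F s 0) (s : S) :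
    0 ≤ V s :=
  ge_of_tendsto' (hV.tendsto_valueIter h s) fun k => valueIter_nonneg h P.γ_nonneg h0 k s

lemma abs_qValue_le_cap (h : E.IsSmooth P.L P.M) (hV : E.IsValue P.γ V) (s : S) (a : Fin P.K) :
    |E.qValue P.γ V s a| ≤ P.cap := by
  linarith [E.abs_qValue_le P.γ_nonneg (hV.abs_le_cap h) s a, P.cap_eq, P.M_nonneg]

end IsValue

namespace ClipLevel

variable {lo : ℝ}

lemma le_qValue (hc : E.ClipLevel P V lo) (h : E.IsSmooth P.L P.M) (hV : E.IsValue P.γ V) (s : S)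
    (a : Fin P.K) : lo ≤ E.qValue P.γ V s a := by
  rcases hc with ⟨rfl, hF | hQ⟩ | rfl
  · exact E.qValue_nonneg P.γ_nonneg (hV.nonneg h hF) s a
  · exact hQ s a
  · exact (abs_le.1 (hV.abs_qValue_le_cap h s a)).1

lemma neg_cap_le (hc : E.ClipLevel P V lo) : -P.cap ≤ lo := by
  rcases hc with ⟨rfl, -⟩ | rfl
  · exact neg_nonpos.2 P.cap_pos.le
  · exact le_rfl

end ClipLevel

end Env

/-! ## Measures that agree up to a small mass -/

/-- `μ` exceeds `ν` by at most `η`. Testing against measurable functions with values in `[0, 1]`,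
rather than against measurable sets, makes the notion stable under products of kernels. -/
def LeUpTo {α : Type*} [MeasurableSpace α] (η : ENNReal) (μ ν : Measure α) : Prop :=
  ∀ f : α → ENNReal, Measurable f → (∀ x, f x ≤ 1) → ∫⁻ x, f x ∂μ ≤ ∫⁻ x, f x ∂ν + η

lemma lintegral_le_one {α : Type*} [MeasurableSpace α] (μ : Measure α) [IsProbabilityMeasure μ]
    {f : α → ENNReal} (hf : ∀ x, f x ≤ 1) : ∫⁻ x, f x ∂μ ≤ 1 :=
  (lintegral_mono hf).trans_eq (by simp)

namespace LeUpTo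

variable {α β ι : Type*} [MeasurableSpace α] [MeasurableSpace β] {η ζ : ENNReal}
  {μ ν ρ : Measure α}

lemma refl (μ : Measure α) (η : ENNReal) : LeUpTo η μ μ := fun _ _ _ => le_self_add

lemma mono (h : LeUpTo η μ ν) (hle : η ≤ ζ) : LeUpTo ζ μ ν := fun f hf h1 =>
  (h f hf h1).trans (add_le_add le_rfl hle)

lemma trans (h : LeUpTo η μ ν) (h' : LeUpTo ζ ν ρ) : LeUpTo (η + ζ) μ ρ := fun f hf h1 =>
  calc ∫⁻ x, f x ∂μ ≤ ∫⁻ x, f x ∂ν + η := h f hf h1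
    _ ≤ (∫⁻ x, f x ∂ρ + ζ) + η := add_le_add (h' f hf h1) le_rfl
    _ = ∫⁻ x, f x ∂ρ + (η + ζ) := by rw [add_assoc, add_comm ζ]

lemma map (h : LeUpTo η μ ν) {g : α → β} (hg : Measurable g) :
    LeUpTo η (μ.map g) (ν.map g) := by
  intro f hf h1
  rw [lintegral_map hf hg, lintegral_map hf hg]
  exact h _ (hf.comp hg) fun x => h1 _

lemma measure_le (h : LeUpTo η μ ν) {A : Set α} (hA : MeasurableSet A) : μ A ≤ ν A + η := by
  have := h (A.indicator 1) (measurable_one.indicator hA)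
    (fun x => Set.indicator_le_self' (fun _ _ => zero_le) x)
  simpa [lintegral_indicator_one hA] using this

lemma of_eqOn_compl {g h : α → β} (hg : Measurable g) (hh : Measurable h) {A : Set α}
    (hA : MeasurableSet A) (hgh : Set.EqOn g h Aᶜ) (hμ : μ A ≤ η) :
    LeUpTo η (μ.map g) (μ.map h) := by
  intro f hf h1
  rw [lintegral_map hf hg, lintegral_map hf hh]
  calc ∫⁻ x, f (g x) ∂μ ≤ ∫⁻ x, (f (h x) + A.indicator 1 x) ∂μ := by
        refine lintegral_mono fun x => ?_
        by_cases hx : x ∈ A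
        · simpa [hx] using (h1 _).trans le_add_self
        · simp [hx, hgh hx]
    _ = ∫⁻ x, f (h x) ∂μ + μ A := by
        rw [lintegral_add_left (f := fun x => f (h x)) (hf.comp hh), lintegral_indicator_one hA]
    _ ≤ ∫⁻ x, f (h x) ∂μ + η := by gcongr

lemma compProd {κ κ' : Kernel α β} {γ : Type*} [MeasurableSpace γ] {ξ ξ' : Kernel (α × β) γ}
    [IsMarkovKernel κ] [IsMarkovKernel κ'] [IsMarkovKernel ξ] [IsMarkovKernel ξ'] {a : α}
    (h : LeUpTo η (κ a) (κ' a)) (h' : ∀ b, LeUpTo ζ (ξ (a, b)) (ξ' (a, b))) :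
    LeUpTo (η + ζ) ((κ ⊗ₖ ξ) a) ((κ' ⊗ₖ ξ') a) := by
  intro f hf h1
  rw [Kernel.lintegral_compProd _ _ _ hf, Kernel.lintegral_compProd _ _ _ hf]
  have hinner : Measurable fun b => ∫⁻ c, f (b, c) ∂ξ' (a, b) :=
    Measurable.lintegral_kernel_prod_right' (κ := ξ'.comap (Prod.mk a) (by fun_prop)) hf
  calc ∫⁻ b, ∫⁻ c, f (b, c) ∂ξ (a, b) ∂κ a
      ≤ ∫⁻ b, (∫⁻ c, f (b, c) ∂ξ' (a, b) + ζ) ∂κ a :=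
        lintegral_mono fun b => h' b _ (by fun_prop) fun _ => h1 _
    _ = ∫⁻ b, ∫⁻ c, f (b, c) ∂ξ' (a, b) ∂κ a + ζ := by
        rw [lintegral_add_right _ measurable_const]
        simp
    _ ≤ (∫⁻ b, ∫⁻ c, f (b, c) ∂ξ' (a, b) ∂κ' a + η) + ζ :=
        add_le_add (h _ hinner fun b => lintegral_le_one _ fun _ => h1 _) le_rfl
    _ = ∫⁻ b, ∫⁻ c, f (b, c) ∂ξ' (a, b) ∂κ' a + (η + ζ) := by rw [add_assoc]

variable {μ ν : ι → Measure α} [∀ i, IsProbabilityMeasure (μ i)] [∀ i, IsProbabilityMeasure (ν i)]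

-- One coordinate is replaced at a time.
lemma lmarginal_le [DecidableEq ι] (h : ∀ i, LeUpTo η (μ i) (ν i)) {f : (ι → α) → ENNReal}
    (hf : Measurable f) (h1 : ∀ x, f x ≤ 1) (s : Finset ι) (x : ι → α) :
    (∫⋯∫⁻_s, f ∂μ) x ≤ (∫⋯∫⁻_s, f ∂ν) x + s.card * η := by
  induction s using Finset.induction_on generalizing x with
  | empty => simp
  | insert i s hi ih =>
    have hle (y) : (∫⋯∫⁻_s, f ∂ν) y ≤ 1 := lintegral_le_one _ fun _ => h1 _
    have hm : Measurable fun z => (∫⋯∫⁻_s, f ∂ν) (Function.update x i z) :=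
      (hf.lmarginal ν).comp (measurable_update x)
    rw [lmarginal_insert f hf hi, lmarginal_insert f hf hi]
    calc ∫⁻ z, (∫⋯∫⁻_s, f ∂μ) (Function.update x i z) ∂μ i
        ≤ ∫⁻ z, ((∫⋯∫⁻_s, f ∂ν) (Function.update x i z) + s.card * η) ∂μ i :=
          lintegral_mono fun z => ih _
      _ = ∫⁻ z, (∫⋯∫⁻_s, f ∂ν) (Function.update x i z) ∂μ i + s.card * η := by
          rw [lintegral_add_right _ measurable_const]
          simp
      _ ≤ (∫⁻ z, (∫⋯∫⁻_s, f ∂ν) (Function.update x i z) ∂ν i + η) + s.card * η :=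
          add_le_add (h i _ hm fun _ => hle _) le_rfl
      _ = ∫⁻ z, (∫⋯∫⁻_s, f ∂ν) (Function.update x i z) ∂ν i + (insert i s).card * η := by
          rw [Finset.card_insert_of_notMem hi]
          push_cast
          ring

lemma pi [Fintype ι] (h : ∀ i, LeUpTo η (μ i) (ν i)) :
    LeUpTo (Fintype.card ι * η) (Measure.pi μ) (Measure.pi ν) := by
  classical
  intro f hf h1
  rcases isEmpty_or_nonempty ι with hι | ⟨⟨i⟩⟩
  · rw [Measure.pi_of_empty μ, Measure.pi_of_empty ν]
    exact le_self_add
  · obtain ⟨a⟩ : Nonempty α := (μ i).nonempty_of_neZero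
    have := lmarginal_le h hf h1 Finset.univ fun _ => a
    rwa [← lintegral_eq_lmarginal_univ, ← lintegral_eq_lmarginal_univ] at this

end LeUpTo

/-! ## The building blocks of the algorithm -/

section Kernels

variable {S X ι : Type*} [MeasurableSpace S] [MeasurableSpace X] [Fintype ι]

lemma id_prod_eq_map (G : Kernel S X) [IsSFiniteKernel G] (s : S) :
    (Kernel.id ×ₖ G) s = (G s).map (Prod.mk s) := by
  ext t ht
  rw [Kernel.id_prod_apply' _ _ ht, Measure.map_apply measurable_prodMk_left ht]

lemma indepKernel_apply (κ : ι → Kernel S X) [h : ∀ i, IsMarkovKernel (κ i)] (s : S) :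
    indepKernel κ s = Measure.pi fun i => κ i s := by
  rw [indepKernel, dif_pos h]
  rfl

instance (κ : ι → Kernel S X) [∀ i, IsMarkovKernel (κ i)] : IsMarkovKernel (indepKernel κ) :=
  ⟨fun s => by rw [indepKernel_apply]; infer_instance⟩

end Kernels

namespace Env

variable {S : Type u} [MeasurableSpace S] {K : ℕ} (E : Env S K)

lemma IsSmooth.isMarkovKernel_draw {E : Env S K} {L M : ℝ} (h : E.IsSmooth L M) :
    IsMarkovKernel E.draw := by
  refine ⟨fun p => isProbabilityMeasure_sum_dirac
    (fun a => div_nonneg (h.grad_nonneg _ _ a) (h.gradNorm_pos _ _).le) ?_⟩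
  rw [← Finset.sum_div, ← h.gradNorm_eq, div_self (h.gradNorm_pos _ _).ne']

section SampleQ

variable (γ : ℝ) (T : Kernel S (ℝ × ℕ)) [IsMarkovKernel T]

lemma measurable_sampleQ_out :
    Measurable fun p : (ℝ × S) × (ℝ × ℕ) => (p.1.1 + γ * p.2.1, p.2.2 + 1) := by fun_prop

instance : IsMarkovKernel (E.sampleQ γ T) :=
  Kernel.IsMarkovKernel.map _ (measurable_sampleQ_out γ)

lemma ae_sampleQ_iff {p : ℝ × ℕ → Prop} (hp : MeasurableSet {x | p x}) (q : S × Fin K) :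
    (∀ᵐ x ∂E.sampleQ γ T q, p x) ↔
      ∀ᵐ o ∂E.oracle q, ∀ᵐ v ∂T o.2, p (o.1 + γ * v.1, v.2 + 1) := by
  rw [sampleQ, Kernel.map_apply _ (measurable_sampleQ_out γ),
    ae_map_iff (measurable_sampleQ_out γ).aemeasurable hp]
  exact Kernel.ae_compProd_iff (measurable_sampleQ_out γ hp)

lemma integral_sampleQ {q : S × Fin K} {f : ℝ × ℕ → ℝ} (hf : Measurable f)
    (hi : Integrable f (E.sampleQ γ T q)) :
    ∫ x, f x ∂E.sampleQ γ T q =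
      ∫ o, ∫ v, f (o.1 + γ * v.1, v.2 + 1) ∂T o.2 ∂E.oracle q := by
  rw [sampleQ, Kernel.map_apply _ (measurable_sampleQ_out γ)] at hi ⊢
  rw [integral_map (measurable_sampleQ_out γ).aemeasurable hf.aestronglyMeasurable]
  exact ProbabilityTheory.integral_compProd (hi.comp_measurable (measurable_sampleQ_out γ))

variable {T} in
lemma leUpTo_sampleQ {T' : Kernel S (ℝ × ℕ)} [IsMarkovKernel T'] {η : ENNReal}
    (h : ∀ s, LeUpTo η (T s) (T' s)) (q : S × Fin K) :
    LeUpTo η (E.sampleQ γ T q) (E.sampleQ γ T' q) := by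
  rw [sampleQ, sampleQ, Kernel.map_apply _ (measurable_sampleQ_out γ),
    Kernel.map_apply _ (measurable_sampleQ_out γ), ← zero_add η]
  exact .map (.compProd (.refl (E.oracle q) 0) fun b => h b.2) (measurable_sampleQ_out γ)

end SampleQ

/-- The first-order expansion of the Bellman operator at `Q`, with `y` as an estimate of its linear
part. If `y` has mean `Q'ᵀ ∇F_s(Q) / ‖∇F_s(Q)‖₁`, then it is an unbiased estimate of the first-order
approximation of `F_s(Q')`. -/
noncomputable def linearized (s : S) (Q : Fin K → ℝ) (y : ℝ) : ℝ :=
  E.F s Q - ∑ a, Q a * E.grad s Q a + y * E.gradNorm s Q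

@[fun_prop]
lemma measurable_linearized_comp {X : Type*} [MeasurableSpace X] {f : X → S} {g : X → Fin K → ℝ}
    {y : X → ℝ} (hf : Measurable f) (hg : Measurable g) (hy : Measurable y) :
    Measurable fun x => E.linearized (f x) (g x) (y x) := by
  unfold linearized
  fun_prop

/-- Apply the Bellman operator to an estimate of the `Q`-values drawn from `G`: the second case of
`sampleV`, and `smoothCruiser`. -/
noncomputable def evalStep (G : Kernel S ((Fin K → ℝ) × ℕ)) : Kernel S (ℝ × ℕ) :=
  (Kernel.id ×ₖ G).map fun p => (E.F p.1 p.2.1, p.2.2)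

/-- Linearize the Bellman operator at an estimate of the `Q`-values drawn from `G`, and estimate
the linear part by a single sample from `H`: the last case of `sampleV`. -/
noncomputable def linStep (G : Kernel S ((Fin K → ℝ) × ℕ)) (H : Kernel (S × Fin K) (ℝ × ℕ)) :
    Kernel S (ℝ × ℕ) :=
  (((Kernel.id ×ₖ G) ⊗ₖ
      E.draw.comap (fun p : S × (S × ((Fin K → ℝ) × ℕ)) => (p.2.1, p.2.2.1)) (by fun_prop)) ⊗ₖ
    H.comap (fun p : S × ((S × ((Fin K → ℝ) × ℕ)) × Fin K) => (p.1, p.2.2)) (by fun_prop)).map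
    fun p => (E.linearized p.1.1.1 p.1.1.2.1 p.2.1, p.1.1.2.2 + p.2.2)

lemma measurable_evalStep_out :
    Measurable fun p : S × ((Fin K → ℝ) × ℕ) => (E.F p.1 p.2.1, p.2.2) := by fun_prop

lemma measurable_linStep_out :
    Measurable fun p : ((S × ((Fin K → ℝ) × ℕ)) × Fin K) × (ℝ × ℕ) =>
      (E.linearized p.1.1.1 p.1.1.2.1 p.2.1, p.1.1.2.2 + p.2.2) := by fun_prop

section EvalStep

variable (G : Kernel S ((Fin K → ℝ) × ℕ)) [IsMarkovKernel G]

instance : IsMarkovKernel (E.evalStep G) :=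
  Kernel.IsMarkovKernel.map _ E.measurable_evalStep_out

lemma evalStep_apply (s : S) : E.evalStep G s = (G s).map fun q => (E.F s q.1, q.2) := by
  rw [evalStep, Kernel.map_apply _ E.measurable_evalStep_out, id_prod_eq_map,
    Measure.map_map E.measurable_evalStep_out measurable_prodMk_left]
  rfl

lemma ae_evalStep_iff {p : ℝ × ℕ → Prop} (hp : MeasurableSet {x | p x}) (s : S) :
    (∀ᵐ x ∂E.evalStep G s, p x) ↔ ∀ᵐ q ∂G s, p (E.F s q.1, q.2) := by
  rw [evalStep_apply, ae_map_iff (by fun_prop) hp]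

variable {G} in
lemma leUpTo_evalStep {G' : Kernel S ((Fin K → ℝ) × ℕ)} [IsMarkovKernel G'] {η : ENNReal} {s : S}
    (h : LeUpTo η (G s) (G' s)) : LeUpTo η (E.evalStep G s) (E.evalStep G' s) := by
  rw [evalStep_apply, evalStep_apply]
  exact h.map (by fun_prop)

end EvalStep

section LinStep

variable (G : Kernel S ((Fin K → ℝ) × ℕ)) [IsMarkovKernel G]
  (H : Kernel (S × Fin K) (ℝ × ℕ)) [IsMarkovKernel H]

lemma ae_linStep {p : ℝ × ℕ → Prop} (hp : MeasurableSet {x | p x}) {s : S}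
    (h : ∀ᵐ q ∂G s, ∀ a, ∀ᵐ v ∂H (s, a), p (E.linearized s q.1 v.1, q.2 + v.2)) :
    ∀ᵐ x ∂E.linStep G H s, p x := by
  rw [linStep, Kernel.map_apply _ E.measurable_linStep_out,
    ae_map_iff E.measurable_linStep_out.aemeasurable hp]
  have hinner : MeasurableSet {b : (S × ((Fin K → ℝ) × ℕ)) × Fin K | ∀ᵐ v ∂H (s, b.2),
      p (E.linearized b.1.1 b.1.2.1 v.1, b.1.2.2 + v.2)} :=
    Kernel.measurable_kernel_prodMk_left' (η := H.comap
      (fun b : S × ((S × ((Fin K → ℝ) × ℕ)) × Fin K) => (b.1, b.2.2)) (by fun_prop))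
      (E.measurable_linStep_out hp).compl s (measurableSet_singleton 0)
  have houter : MeasurableSet {b : S × ((Fin K → ℝ) × ℕ) | ∀ a, ∀ᵐ v ∂H (s, a),
      p (E.linearized b.1 b.2.1 v.1, b.2.2 + v.2)} := by
    simp only [Set.ofPred_forall]
    exact .iInter fun a => hinner.preimage (measurable_prodMk_right (y := a))
  refine Kernel.ae_compProd_of_ae_ae (E.measurable_linStep_out hp)
    (Kernel.ae_compProd_of_ae_ae hinner ?_)
  rw [id_prod_eq_map]
  filter_upwards [(ae_map_iff measurable_prodMk_left.aemeasurable houter).2 h] with b hb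
  exact .of_forall hb

variable [IsMarkovKernel E.draw]

instance : IsMarkovKernel (E.linStep G H) :=
  Kernel.IsMarkovKernel.map _ E.measurable_linStep_out

lemma integral_linStep {f : ℝ × ℕ → ℝ} (hf : Measurable f) {s : S}
    (hi : Integrable f (E.linStep G H s)) :
    ∫ x, f x ∂E.linStep G H s =
      ∫ q, ∫ a, ∫ v, f (E.linearized s q.1 v.1, q.2 + v.2) ∂H (s, a) ∂E.draw (s, q.1) ∂G s := by
  have hm := E.measurable_linStep_out
  rw [linStep, Kernel.map_apply _ hm] at hi ⊢
  have hi' := hi.comp_measurable hm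
  rw [integral_map hm.aemeasurable hf.aestronglyMeasurable]
  have hmeas := hi'.integral_compProd.integral_compProd.aestronglyMeasurable
  rw [id_prod_eq_map] at hmeas
  refine (ProbabilityTheory.integral_compProd hi').trans
    ((ProbabilityTheory.integral_compProd hi'.integral_compProd).trans ?_)
  rw [id_prod_eq_map]
  exact integral_map measurable_prodMk_left.aemeasurable hmeas

variable {G H} in
lemma leUpTo_linStep {G' : Kernel S ((Fin K → ℝ) × ℕ)} [IsMarkovKernel G']
    {H' : Kernel (S × Fin K) (ℝ × ℕ)} [IsMarkovKernel H'] {η ζ : ENNReal} {s : S}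
    (hG : LeUpTo η (G s) (G' s)) (hH : ∀ p, LeUpTo ζ (H p) (H' p)) :
    LeUpTo (η + ζ) (E.linStep G H s) (E.linStep G' H' s) := by
  have hprod : LeUpTo η ((Kernel.id ×ₖ G) s) ((Kernel.id ×ₖ G') s) := by
    rw [id_prod_eq_map, id_prod_eq_map]
    exact hG.map measurable_prodMk_left
  rw [linStep, linStep, Kernel.map_apply _ E.measurable_linStep_out,
    Kernel.map_apply _ E.measurable_linStep_out, ← add_zero η]
  exact .map (.compProd (.compProd hprod fun _ => .refl _ 0)
    fun b => hH (s, b.2)) E.measurable_linStep_out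

end LinStep

end Env

/-! ## The recursion and the number of oracle calls -/

namespace Params

variable (P : Params)

lemma sqrt_lt_one : √P.γ < 1 := (Real.sqrt_lt' one_pos).2 (by simpa using P.γ_lt_one)

lemma kappa_pos : 0 < P.kappa := by
  have := P.sqrt_lt_one
  have := P.L_pos
  have : (0 : ℝ) < P.K := Nat.cast_pos.2 P.K_pos
  exact div_pos (by linarith) (by positivity)

lemma relax_pos {ε : ℝ} (hε : 0 < ε) : 0 < P.relax ε := by
  unfold relax
  split_ifs with h
  · exact P.cap_pos
  · have := lt_of_le_of_ne P.γ_nonneg (Ne.symm h)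
    positivity

lemma accuracy_induction {p : ℝ → Prop} (coarse : ∀ ε, P.cap ≤ ε → p ε)
    (middle : ∀ ε, 0 < ε → ε < P.cap → P.kappa ≤ ε → p (P.relax ε) → p ε)
    (fine : ∀ ε, 0 < ε → ε < P.cap → ε < P.kappa → p (P.relax √(P.kappa * ε)) →
      p (P.relax ε) → p ε) {ε : ℝ} (hε : 0 < ε) : p ε := by
  induction hd : P.depth ε using Nat.strong_induction_on generalizing ε with
  | _ d ih =>
    subst hd
    rcases le_or_gt P.cap ε with hc | hc
    · exact coarse ε hc
    rcases le_or_gt P.kappa ε with hk | hk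
    · exact middle ε hε hc hk (ih _ (P.depth_lt hε hc le_rfl) (P.relax_pos hε) rfl)
    · have := P.kappa_pos
      exact fine ε hε hc hk
        (ih _ (P.depth_lt hε hc (P.le_sqrt_kappa hε hk)) (P.relax_pos (by positivity)) rfl)
        (ih _ (P.depth_lt hε hc le_rfl) (P.relax_pos hε) rfl)

/-- The number of oracle calls of `estimateQ(·, ε)` if the procedure that it calls makes `c`. -/
noncomputable def callsQ (δ' : ℝ) (c : ℕ) (ε : ℝ) : ℕ := P.K * P.N δ' ε * (c + 1)

/-- The number of oracle calls of `sampleV(·, ε)`. -/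
noncomputable def callsV (δ' ε : ℝ) : ℕ :=
  if _h : ε ≤ 0 ∨ P.cap ≤ ε then 0
  else if _hκ : P.kappa ≤ ε then P.callsQ δ' (callsV δ' (P.relax ε)) ε
  else P.callsQ δ' (callsV δ' (P.relax √(P.kappa * ε))) √(P.kappa * ε)
    + (callsV δ' (P.relax ε) + 1)
termination_by P.depth ε
decreasing_by
  · push Not at _h
    exact P.depth_lt _h.1 _h.2 le_rfl
  · push Not at _h _hκ
    exact P.depth_lt _h.1 _h.2 (P.le_sqrt_kappa _h.1 _hκ)
  · push Not at _h
    exact P.depth_lt _h.1 _h.2 le_rfl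

/-- The number of oracle calls of `SmoothCruiser(·, ε, δ')`. -/
noncomputable def calls (ε δ' : ℝ) : ℕ := P.callsQ δ' (P.callsV δ' (P.relax ε)) ε

variable {P} (δ' : ℝ) {ε : ℝ}

lemma callsV_of_cap_le (h : P.cap ≤ ε) : P.callsV δ' ε = 0 := by
  rw [callsV, dif_pos (Or.inr h)]

lemma callsV_of_kappa_le (hε : 0 < ε) (hc : ε < P.cap) (hk : P.kappa ≤ ε) :
    P.callsV δ' ε = P.callsQ δ' (P.callsV δ' (P.relax ε)) ε := by
  rw [callsV, dif_neg (by push Not; exact ⟨hε, hc⟩), dif_pos hk]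

lemma callsV_of_lt_kappa (hε : 0 < ε) (hc : ε < P.cap) (hk : ε < P.kappa) :
    P.callsV δ' ε = P.callsQ δ' (P.callsV δ' (P.relax √(P.kappa * ε))) √(P.kappa * ε)
      + (P.callsV δ' (P.relax ε) + 1) := by
  rw [callsV, dif_neg (by push Not; exact ⟨hε, hc⟩), dif_neg hk.not_ge]

end Params

namespace Env

variable {S : Type u} [MeasurableSpace S] {P : Params} (E : Env S P.K) (lo δ' : ℝ)

lemma measurableSet_snd_eq {β : Type*} [MeasurableSpace β] (n : ℕ) :
    MeasurableSet {x : β × ℕ | x.2 = n} :=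
  measurable_snd (measurableSet_singleton n)

lemma ae_sampleQ_calls {T : Kernel S (ℝ × ℕ)} [IsMarkovKernel T] {c : ℕ}
    (h : ∀ s, ∀ᵐ x ∂T s, x.2 = c) (p : S × Fin P.K) :
    ∀ᵐ x ∂E.sampleQ P.γ T p, x.2 = c + 1 := by
  refine (ae_sampleQ_iff E P.γ T (p := fun x => x.2 = c + 1) (measurableSet_snd_eq _) _).2 ?_
  refine Eventually.of_forall fun o => ?_
  filter_upwards [h o.2] with v hv
  rw [hv]

lemma ae_evalStep_calls {G : Kernel S ((Fin P.K → ℝ) × ℕ)} [IsMarkovKernel G] {s : S} {n : ℕ}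
    (h : ∀ᵐ q ∂G s, q.2 = n) : ∀ᵐ x ∂E.evalStep G s, x.2 = n :=
  (ae_evalStep_iff E G (p := fun x => x.2 = n) (measurableSet_snd_eq n) s).2 h


section EstimateQ

/-- The estimates that `estimateQ` computes from its samples, with the total of their counters. -/
noncomputable def clippedMeans (P : Params) (lo : ℝ) (n : ℕ)
    (w : Fin P.K × Fin n → ℝ × ℕ) : (Fin P.K → ℝ) × ℕ :=
  (fun a => min P.cap (max lo ((∑ k, (w (a, k)).1) / n)), ∑ i, (w i).2)

lemma measurable_clippedMeans (n : ℕ) : Measurable (clippedMeans P lo n) := by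
  unfold clippedMeans
  fun_prop

variable (T : Kernel S (ℝ × ℕ)) [IsMarkovKernel T] (ε : ℝ)

instance : IsMarkovKernel (estimateQ P E lo δ' T ε) :=
  Kernel.IsMarkovKernel.map _ (measurable_clippedMeans lo _)

lemma estimateQ_apply (s : S) : estimateQ P E lo δ' T ε s =
    (Measure.pi fun i : Fin P.K × Fin (P.N δ' ε) => E.sampleQ P.γ T (s, i.1)).map
      (clippedMeans P lo _) := by
  have h := Kernel.map_apply (indepKernel fun i : Fin P.K × Fin (P.N δ' ε) =>
    (E.sampleQ P.γ T).comap (fun s => (s, i.1)) (by fun_prop)) (measurable_clippedMeans lo _) s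
  rw [indepKernel_apply] at h
  exact h

variable {T} in
lemma leUpTo_estimateQ {T' : Kernel S (ℝ × ℕ)} [IsMarkovKernel T'] {η : ENNReal}
    (h : ∀ s, LeUpTo η (T s) (T' s)) (s : S) :
    LeUpTo ((P.K * P.N δ' ε : ℕ) * η) (estimateQ P E lo δ' T ε s) (estimateQ P E lo δ' T' ε s) := by
  rw [estimateQ_apply, estimateQ_apply]
  have := (LeUpTo.pi fun i : Fin P.K × Fin (P.N δ' ε) => E.leUpTo_sampleQ P.γ h (s, i.1)).map
    (measurable_clippedMeans (P := P) lo (P.N δ' ε))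
  simpa using this

variable {T} {ε} in
lemma ae_estimateQ_calls {c : ℕ} (h : ∀ s, ∀ᵐ x ∂T s, x.2 = c) (s : S) :
    ∀ᵐ q ∂estimateQ P E lo δ' T ε s, q.2 = P.callsQ δ' c ε := by
  rw [estimateQ_apply,
    ae_map_iff (measurable_clippedMeans lo _).aemeasurable (measurableSet_snd_eq _)]
  have h2 : ∀ᵐ w ∂(Measure.pi fun i : Fin P.K × Fin (P.N δ' ε) => E.sampleQ P.γ T (s, i.1)),
      ∀ i, (w i).2 = c + 1 :=
    ae_all_iff.2 fun i => (Measure.quasiMeasurePreserving_eval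
      (fun i : Fin P.K × Fin (P.N δ' ε) => E.sampleQ P.γ T (s, i.1)) i).ae
      (E.ae_sampleQ_calls h (s, i.1))
  filter_upwards [h2] with w hw
  simp [clippedMeans, hw, Params.callsQ]

end EstimateQ

section SampleV

variable {ε : ℝ}

lemma sampleV_of_cap_le (h : P.cap ≤ ε) :
    sampleV P E lo δ' ε = Kernel.const S (Measure.dirac (0, 0)) := by
  rw [sampleV, dif_pos (Or.inr h)]

lemma sampleV_of_kappa_le (hε : 0 < ε) (hc : ε < P.cap) (hk : P.kappa ≤ ε) :
    sampleV P E lo δ' ε =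
      E.evalStep (estimateQ P E lo δ' (sampleV P E lo δ' (P.relax ε)) ε) := by
  rw [sampleV, dif_neg (by push Not; exact ⟨hε, hc⟩), dif_pos hk]
  rfl

lemma sampleV_of_lt_kappa (hε : 0 < ε) (hc : ε < P.cap) (hk : ε < P.kappa) :
    sampleV P E lo δ' ε =
      E.linStep (estimateQ P E lo δ' (sampleV P E lo δ' (P.relax √(P.kappa * ε))) √(P.kappa * ε))
        (E.sampleQ P.γ (sampleV P E lo δ' (P.relax ε))) := by
  rw [sampleV, dif_neg (by push Not; exact ⟨hε, hc⟩), dif_neg hk.not_ge]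
  rfl

lemma smoothCruiser_eq : smoothCruiser P E lo δ' ε =
    E.evalStep (estimateQ P E lo δ' (sampleV P E lo δ' (P.relax ε)) ε) := rfl

variable [IsMarkovKernel E.draw]

lemma isMarkovKernel_sampleV (hε : 0 < ε) : IsMarkovKernel (sampleV P E lo δ' ε) := by
  refine P.accuracy_induction (p := fun ε => IsMarkovKernel (sampleV P E lo δ' ε))
    (fun ε hc => ?_) (fun ε hε hc hk ih => ?_) (fun ε hε hc hk ih ih' => ?_) hε
  · rw [sampleV_of_cap_le E lo δ' hc]
    infer_instance
  · rw [sampleV_of_kappa_le E lo δ' hε hc hk]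
    infer_instance
  · rw [sampleV_of_lt_kappa E lo δ' hε hc hk]
    infer_instance

lemma ae_sampleV_calls (hε : 0 < ε) (s : S) :
    ∀ᵐ x ∂sampleV P E lo δ' ε s, x.2 = P.callsV δ' ε := by
  refine P.accuracy_induction
    (p := fun ε => ∀ s, ∀ᵐ x ∂sampleV P E lo δ' ε s, x.2 = P.callsV δ' ε)
    (fun ε hc s => ?_) (fun ε hε hc hk ih s => ?_) (fun ε hε hc hk ih ih' s => ?_) hε s
  · rw [sampleV_of_cap_le E lo δ' hc, Params.callsV_of_cap_le δ' hc, Kernel.const_apply,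
      ae_dirac_iff (measurableSet_snd_eq 0)]
  · have := E.isMarkovKernel_sampleV lo δ' (P.relax_pos hε)
    rw [sampleV_of_kappa_le E lo δ' hε hc hk, Params.callsV_of_kappa_le δ' hε hc hk]
    exact E.ae_evalStep_calls (E.ae_estimateQ_calls lo δ' ih s)
  · have hκ := P.kappa_pos
    have := E.isMarkovKernel_sampleV lo δ' (P.relax_pos hε)
    have := E.isMarkovKernel_sampleV lo δ' (P.relax_pos (ε := √(P.kappa * ε)) (by positivity))
    rw [sampleV_of_lt_kappa E lo δ' hε hc hk, Params.callsV_of_lt_kappa δ' hε hc hk]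
    refine E.ae_linStep _ _ (measurableSet_snd_eq _) ?_
    filter_upwards [E.ae_estimateQ_calls lo δ' ih s] with q hq a
    filter_upwards [E.ae_sampleQ_calls ih' (s, a)] with v hv
    rw [hq, hv]

lemma isMarkovKernel_smoothCruiser (hε : 0 < ε) : IsMarkovKernel (smoothCruiser P E lo δ' ε) := by
  have := E.isMarkovKernel_sampleV lo δ' (P.relax_pos hε)
  rw [smoothCruiser_eq]
  infer_instance

lemma ae_smoothCruiser_calls (hε : 0 < ε) (s : S) :
    ∀ᵐ x ∂smoothCruiser P E lo δ' ε s, x.2 = P.calls ε δ' := by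
  have := E.isMarkovKernel_sampleV lo δ' (P.relax_pos hε)
  rw [smoothCruiser_eq]
  exact E.ae_evalStep_calls
    (E.ae_estimateQ_calls lo δ' (E.ae_sampleV_calls lo δ' (P.relax_pos hε)) s)

end SampleV

end Env

/-! ## Concentration of the estimates -/

section Hoeffding

variable {Ω ι : Type*} [MeasurableSpace Ω] {μ : Measure Ω} [IsProbabilityMeasure μ] [Fintype ι]
  {X : ι → Ω → ℝ} {a b m t : ℝ}

lemma measureReal_card_mul_le_sum_sub_le (hind : iIndepFun X μ) (hX : ∀ i, AEMeasurable (X i) μ)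
    (hb : ∀ i, ∀ᵐ ω ∂μ, X i ω ∈ Set.Icc a b) (hm : ∀ i, ∫ ω, X i ω ∂μ = m) (ht : 0 ≤ t) :
    μ.real {ω | Fintype.card ι * t ≤ ∑ i, (X i ω - m)} ≤
      Real.exp (-(2 * Fintype.card ι * t ^ 2 / (b - a) ^ 2)) := by
  have hsub : ∀ i ∈ (Finset.univ : Finset ι),
      HasSubgaussianMGF (fun ω => X i ω - m) ((‖b - a‖₊ / 2) ^ 2) μ := fun i _ => by
    simpa only [hm i] using hasSubgaussianMGF_of_mem_Icc (hX i) (hb i)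
  have h := HasSubgaussianMGF.measure_sum_ge_le_of_iIndepFun
    (hind.comp (fun _ x => x - m) fun _ => measurable_id.sub_const m) hsub
    (mul_nonneg (Nat.cast_nonneg (Fintype.card ι)) ht)
  refine h.trans (Real.exp_le_exp.2 (le_of_eq ?_))
  simp only [Finset.sum_const, Finset.card_univ, nsmul_eq_mul]
  push_cast
  rw [Real.norm_eq_abs, div_pow, sq_abs]
  rcases eq_or_ne (Fintype.card ι : ℝ) 0 with hι | hι
  · simp [hι]
  rcases eq_or_ne (b - a) 0 with hab | hab
  · simp [hab]
  field_simp

lemma measureReal_le_abs_mean_sub_le [Nonempty ι] (hind : iIndepFun X μ)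
    (hX : ∀ i, AEMeasurable (X i) μ) (hb : ∀ i, ∀ᵐ ω ∂μ, X i ω ∈ Set.Icc a b)
    (hm : ∀ i, ∫ ω, X i ω ∂μ = m) (ht : 0 ≤ t) :
    μ.real {ω | t ≤ |(∑ i, X i ω) / Fintype.card ι - m|} ≤
      2 * Real.exp (-(2 * Fintype.card ι * t ^ 2 / (b - a) ^ 2)) := by
  have upper := measureReal_card_mul_le_sum_sub_le hind hX hb hm ht
  have lower := measureReal_card_mul_le_sum_sub_le (X := fun i ω => -X i ω) (a := -b) (b := -a)
    (m := -m) (hind.comp (fun _ x => -x) fun _ => measurable_neg) (fun i => (hX i).neg)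
    (fun i => by
      filter_upwards [hb i] with ω hω
      exact ⟨neg_le_neg hω.2, neg_le_neg hω.1⟩)
    (fun i => by rw [integral_neg, hm i]) ht
  rw [neg_sub_neg] at lower
  have hcard : (0 : ℝ) < Fintype.card ι := Nat.cast_pos.2 Fintype.card_pos
  have hsum (ω : Ω) :
      ∑ i, (X i ω - m) = Fintype.card ι * ((∑ i, X i ω) / Fintype.card ι - m) := by
    rw [Finset.sum_sub_distrib, mul_sub, mul_div_cancel₀ _ hcard.ne']
    simp
  rw [two_mul]
  refine (measureReal_mono fun ω hω => ?_).trans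
    ((measureReal_union_le _ _).trans (add_le_add upper lower))
  refine (le_abs.1 (Set.mem_ofPred.1 hω)).imp (fun h => ?_) fun h => ?_
  · rw [Set.mem_ofPred_eq, hsum]
    gcongr
  · simp only [Set.mem_ofPred_eq, neg_sub_neg, ← neg_sub (X _ ω) m, Finset.sum_neg_distrib, hsum,
      ← mul_neg]
    gcongr

end Hoeffding

namespace Params

variable (P : Params)

/-- A bound on the outputs of `sampleV` as long as all estimates are accurate. -/
noncomputable def range : ℝ := 3 * P.cap / (1 - P.γ)

lemma range_eq : P.range = 3 * P.cap + P.γ * P.range := by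
  have := P.one_sub_pos
  unfold range
  field_simp
  ring

lemma range_nonneg : 0 ≤ P.range := by
  have := P.one_sub_pos
  have := P.cap_pos
  unfold range
  positivity

lemma three_mul_cap_le_range : 3 * P.cap ≤ P.range := by
  linarith [P.range_eq, mul_nonneg P.γ_nonneg P.range_nonneg]

lemma one_add_two_mul_range_le : 1 + 2 * P.γ * P.range ≤ 6 * (1 + P.M) / (1 - P.γ) ^ 2 := by
  have h : 6 * (1 + P.M) / (1 - P.γ) ^ 2 = 2 * P.range := by
    unfold range cap
    field_simp
    ring
  linarith [P.range_eq, P.one_le_cap]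

lemma gamma_mul_relax (ε : ℝ) : P.γ * P.relax ε = √P.γ * ε := by
  unfold relax
  split_ifs with h
  · simp [h]
  · have h0 : 0 < √P.γ := Real.sqrt_pos.2 (lt_of_le_of_ne P.γ_nonneg (Ne.symm h))
    nth_rewrite 1 [← Real.mul_self_sqrt P.γ_nonneg]
    field_simp

variable {P} {δ' ε : ℝ}

lemma N_pos (hδ : 0 < δ') (hδ' : δ' < 2 * P.K) (hε : 0 < ε) : 0 < P.N δ' ε := by
  have := Real.log_pos ((one_lt_div hδ).2 hδ')
  have := P.one_sub_pos
  have := P.M_nonneg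
  have := sub_pos.2 P.sqrt_lt_one
  exact Nat.ceil_pos.2 (by positivity)

lemma log_le_two_mul_N_mul_div (hε : 0 < ε) :
    Real.log (2 * P.K / δ') ≤
      2 * P.N δ' ε * ((1 - √P.γ) * ε) ^ 2 / (1 + 2 * P.γ * P.range) ^ 2 := by
  have := P.one_sub_pos
  have hs := sub_pos.2 P.sqrt_lt_one
  have hM : 0 < 1 + P.M := by linarith [P.M_nonneg]
  have hr : 0 < 1 + 2 * P.γ * P.range := by linarith [mul_nonneg P.γ_nonneg P.range_nonneg]
  have hN : 18 * (1 + P.M) ^ 2 / ((1 - P.γ) ^ 4 * (1 - √P.γ) ^ 2) *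
      (Real.log (2 * P.K / δ') / ε ^ 2) ≤ P.N δ' ε := Nat.le_ceil _
  calc Real.log (2 * P.K / δ')
      = 2 * (18 * (1 + P.M) ^ 2 / ((1 - P.γ) ^ 4 * (1 - √P.γ) ^ 2) *
          (Real.log (2 * P.K / δ') / ε ^ 2)) * ((1 - √P.γ) * ε) ^ 2 /
          (6 * (1 + P.M) / (1 - P.γ) ^ 2) ^ 2 := by
        field_simp
        ring
    _ ≤ 2 * P.N δ' ε * ((1 - √P.γ) * ε) ^ 2 / (6 * (1 + P.M) / (1 - P.γ) ^ 2) ^ 2 := by gcongr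
    _ ≤ 2 * P.N δ' ε * ((1 - √P.γ) * ε) ^ 2 / (1 + 2 * P.γ * P.range) ^ 2 := by
        gcongr
        exact P.one_add_two_mul_range_le

lemma two_mul_exp_le (hδ : 0 < δ') (hε : 0 < ε) :
    2 * Real.exp (-(2 * P.N δ' ε * ((1 - √P.γ) * ε) ^ 2 / (1 + 2 * P.γ * P.range) ^ 2)) ≤
      δ' / P.K := by
  have hK : (0 : ℝ) < P.K := Nat.cast_pos.2 P.K_pos
  calc _ ≤ 2 * Real.exp (-Real.log (2 * P.K / δ')) := by
        gcongr
        exact log_le_two_mul_N_mul_div hε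
    _ = δ' / P.K := by
        rw [Real.exp_neg, Real.exp_log (by positivity)]
        field_simp

end Params

namespace Env

variable {S : Type u} [MeasurableSpace S] {P : Params} {E : Env S P.K} {V : S → ℝ} {lo δ' ε : ℝ}

/-- The outputs of `T` are bounded estimates of `V` with bias at most `ε`. -/
structure Accurate (P : Params) (V : S → ℝ) (ε : ℝ) (T : Kernel S (ℝ × ℕ)) : Prop where
  bound : ∀ s, ∀ᵐ x ∂T s, |x.1| ≤ P.range
  bias : ∀ s, |∫ x, x.1 ∂T s - V s| ≤ ε

namespace Accurate

variable {T : Kernel S (ℝ × ℕ)} [IsMarkovKernel T]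

lemma ae_sampleQ_mem_Icc (h : Accurate P V ε T) (p : S × Fin P.K) :
    ∀ᵐ x ∂E.sampleQ P.γ T p, x.1 ∈ Set.Icc (-(P.γ * P.range)) (1 + P.γ * P.range) := by
  refine (ae_sampleQ_iff E P.γ T
    (p := fun x => x.1 ∈ Set.Icc (-(P.γ * P.range)) (1 + P.γ * P.range))
    (measurable_fst measurableSet_Icc) p).2 ?_
  filter_upwards [E.reward_mem p] with o ho
  filter_upwards [h.bound o.2] with v hv
  have hγv : |P.γ * v.1| ≤ P.γ * P.range := by
    rw [abs_mul, abs_of_nonneg P.γ_nonneg]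
    exact mul_le_mul_of_nonneg_left hv P.γ_nonneg
  obtain ⟨hlower, hupper⟩ := abs_le.1 hγv
  exact ⟨by linarith [ho.1], by linarith [ho.2]⟩

lemma integrable_sampleQ (h : Accurate P V ε T) (p : S × Fin P.K) :
    Integrable (fun x => x.1) (E.sampleQ P.γ T p) :=
  Integrable.of_mem_Icc _ _ measurable_fst.aemeasurable (h.ae_sampleQ_mem_Icc p)

lemma integral_sampleQ_eq (h : Accurate P V ε T) (s : S) (a : Fin P.K) :
    ∫ x, x.1 ∂E.sampleQ P.γ T (s, a) = E.qValue P.γ (fun z => ∫ x, x.1 ∂T z) s a := by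
  rw [integral_sampleQ E P.γ T measurable_fst (h.integrable_sampleQ _), qValue]
  refine integral_congr_ae (.of_forall fun o => ?_)
  have hint : Integrable (fun v : ℝ × ℕ => v.1) (T o.2) :=
    .of_bound measurable_fst.aestronglyMeasurable P.range (h.bound o.2)
  simp only
  rw [integral_add (integrable_const _) (hint.const_mul _), integral_const_mul]
  simp

lemma abs_integral_sampleQ_sub_le (h : Accurate P V ε T) (hV : Measurable V)
    {B : ℝ} (hB : ∀ s, |V s| ≤ B) (s : S) (a : Fin P.K) :
    |∫ x, x.1 ∂E.sampleQ P.γ T (s, a) - E.qValue P.γ V s a| ≤ P.γ * ε := by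
  have hmean : Measurable fun z => ∫ x, x.1 ∂T z :=
    (StronglyMeasurable.integral_kernel measurable_fst.stronglyMeasurable).measurable
  have hbound (z : S) : |∫ x, x.1 ∂T z| ≤ P.range := by
    simpa using norm_integral_le_of_norm_le_const (f := fun x : ℝ × ℕ => x.1) (h.bound z)
  rw [h.integral_sampleQ_eq]
  exact E.abs_qValue_sub_le P.γ_nonneg hmean hbound hV hB h.bias s a

lemma measure_deviation_le (h : Accurate P V (P.relax ε) T) (hδ : 0 < δ') (hδ' : δ' < 2 * P.K)
    (hε : 0 < ε) (s : S) (a : Fin P.K) :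
    (Measure.pi fun i : Fin P.K × Fin (P.N δ' ε) => E.sampleQ P.γ T (s, i.1))
        {w | (1 - √P.γ) * ε ≤ |(∑ k : Fin (P.N δ' ε), (w (a, k)).1) / P.N δ' ε
          - ∫ x, x.1 ∂E.sampleQ P.γ T (s, a)|} ≤ ENNReal.ofReal (δ' / P.K) := by
  set ν : Fin P.K × Fin (P.N δ' ε) → Measure (ℝ × ℕ) := fun i => E.sampleQ P.γ T (s, i.1)
  have : Nonempty (Fin (P.N δ' ε)) := Fin.pos_iff_nonempty.1 (Params.N_pos hδ hδ' hε)
  have heval (k : Fin (P.N δ' ε)) :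
      MeasurePreserving (Function.eval (a, k)) (Measure.pi ν) (E.sampleQ P.γ T (s, a)) :=
    measurePreserving_eval ν (a, k)
  have hind : iIndepFun (fun (k : Fin (P.N δ' ε)) w => (w (a, k)).1) (Measure.pi ν) :=
    (iIndepFun_pi (μ := ν) (X := fun _ x => x.1) fun _ => measurable_fst.aemeasurable).precomp
      (Prod.mk_right_injective a)
  have hmean (k : Fin (P.N δ' ε)) :
      ∫ w, (w (a, k)).1 ∂Measure.pi ν = ∫ x, x.1 ∂E.sampleQ P.γ T (s, a) := by
    rw [← (heval k).map_eq,
      integral_map (heval k).aemeasurable measurable_fst.aestronglyMeasurable]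
  have hoeffding := measureReal_le_abs_mean_sub_le hind
    (fun k => (measurable_fst.comp (measurable_pi_apply (a, k))).aemeasurable)
    (fun k => (heval k).quasiMeasurePreserving.ae (h.ae_sampleQ_mem_Icc (s, a)))
    hmean (mul_nonneg (sub_nonneg.2 P.sqrt_lt_one.le) hε.le)
  rw [Fintype.card_fin, show 1 + P.γ * P.range - -(P.γ * P.range) = 1 + 2 * P.γ * P.range by ring]
    at hoeffding
  rw [← ofReal_measureReal]
  exact ENNReal.ofReal_le_ofReal (hoeffding.trans (Params.two_mul_exp_le hδ hε))

end Accurate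

end Env

/-! ## Accuracy of the algorithm -/

lemma abs_clip_sub_le {x y lo hi : ℝ} (hlo : lo ≤ y) (hhi : y ≤ hi) :
    |min hi (max lo x) - y| ≤ |x - y| :=
  calc |min hi (max lo x) - y| = |min hi (max lo x) - min hi (max lo y)| := by
        rw [max_eq_right hlo, min_eq_right hhi]
    _ ≤ |max lo x - max lo y| := by
        simpa using abs_min_sub_min_le_max hi (max lo x) hi (max lo y)
    _ ≤ |x - y| := by simpa using abs_max_sub_max_le_max lo x lo y

lemma abs_integral_sub_le {α : Type*} [MeasurableSpace α] {μ : Measure α} [IsProbabilityMeasure μ]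
    {f : α → ℝ} (hf : Integrable f μ) {c ε : ℝ} (h : ∀ᵐ x ∂μ, |f x - c| ≤ ε) :
    |∫ x, f x ∂μ - c| ≤ ε := by
  have hsub : ∫ x, f x ∂μ - c = ∫ x, (f x - c) ∂μ := by
    rw [integral_sub hf (integrable_const c)]
    simp
  rw [hsub]
  simpa using norm_integral_le_of_norm_le_const (f := fun x => f x - c) h

namespace Env

variable {S : Type u} [MeasurableSpace S] {P : Params} {E : Env S P.K} {V : S → ℝ} {lo δ' ε : ℝ}

/-- The estimates `q` of the `Q`-values at `s` are within `ε` of them, and bounded by the a-priori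
bound. -/
def IsGoodEstimate (E : Env S P.K) (V : S → ℝ) (ε : ℝ) (s : S) (q : Fin P.K → ℝ) : Prop :=
  ∀ a, |q a - E.qValue P.γ V s a| ≤ ε ∧ |q a| ≤ P.cap

lemma isGoodEstimate_qValue (h : E.IsSmooth P.L P.M) (hV : E.IsValue P.γ V) (hε : 0 ≤ ε) (s : S) :
    E.IsGoodEstimate V ε s (E.qValue P.γ V s) := fun a =>
  ⟨by simpa using hε, hV.abs_qValue_le_cap h s a⟩

lemma measurableSet_isGoodEstimate (hV : Measurable V) :
    MeasurableSet {p : S × (Fin P.K → ℝ) | E.IsGoodEstimate V ε p.1 p.2} := by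
  have hQ := E.measurable_qValue (γ := P.γ) hV
  have hQa (a : Fin P.K) : Measurable fun p : S × (Fin P.K → ℝ) => E.qValue P.γ V p.1 a :=
    (measurable_pi_apply a).comp (hQ.comp measurable_fst)
  have hq (a : Fin P.K) : Measurable fun p : S × (Fin P.K → ℝ) => p.2 a := by fun_prop
  simp only [IsGoodEstimate, Set.ofPred_forall]
  exact .iInter fun a => (measurableSet_le ((hq a).sub (hQa a)).abs measurable_const).inter
    (measurableSet_le (hq a).abs measurable_const)

lemma isGoodEstimate_clippedMeans (h : E.IsSmooth P.L P.M) (hV : E.IsValue P.γ V)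
    (hlo : E.ClipLevel P V lo) {s : S} {n : ℕ} {w : Fin P.K × Fin n → ℝ × ℕ} {m : Fin P.K → ℝ}
    (hm : ∀ a, |m a - E.qValue P.γ V s a| ≤ √P.γ * ε)
    (hw : ∀ a, |(∑ k, (w (a, k)).1) / n - m a| ≤ (1 - √P.γ) * ε) :
    E.IsGoodEstimate V ε s (clippedMeans P lo n w).1 := by
  refine fun a => ⟨?_, abs_le.2 ⟨?_, min_le_left _ _⟩⟩
  · calc |(clippedMeans P lo n w).1 a - E.qValue P.γ V s a|
        ≤ |(∑ k, (w (a, k)).1) / n - E.qValue P.γ V s a| :=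
          abs_clip_sub_le (hlo.le_qValue h hV s a) (abs_le.1 (hV.abs_qValue_le_cap h s a)).2
      _ ≤ |(∑ k, (w (a, k)).1) / n - m a| + |m a - E.qValue P.γ V s a| := abs_sub_le _ _ _
      _ ≤ ε := by linarith [hm a, hw a]
  · exact le_min (by linarith [P.cap_pos]) (hlo.neg_cap_le.trans (le_max_left _ _))

lemma estimateQ_not_isGoodEstimate_le (h : E.IsSmooth P.L P.M) (hV : E.IsValue P.γ V)
    (hlo : E.ClipLevel P V lo) (hδ : 0 < δ') (hδ' : δ' < 2 * P.K) (hε : 0 < ε)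
    {T : Kernel S (ℝ × ℕ)} [IsMarkovKernel T] (hT : Accurate P V (P.relax ε) T) (s : S) :
    estimateQ P E lo δ' T ε s {q | ¬ E.IsGoodEstimate V ε s q.1} ≤ ENNReal.ofReal δ' := by
  have hK : (0 : ℝ) < P.K := Nat.cast_pos.2 P.K_pos
  have hbad : MeasurableSet {q : (Fin P.K → ℝ) × ℕ | ¬ E.IsGoodEstimate V ε s q.1} :=
    ((measurableSet_isGoodEstimate hV.measurable).preimage
      (measurable_prodMk_left.comp measurable_fst)).compl
  have hm (a : Fin P.K) :
      |∫ x, x.1 ∂E.sampleQ P.γ T (s, a) - E.qValue P.γ V s a| ≤ √P.γ * ε := by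
    rw [← P.gamma_mul_relax]
    exact hT.abs_integral_sampleQ_sub_le hV.measurable (hV.abs_le_cap h) s a
  have hsub : clippedMeans P lo (P.N δ' ε) ⁻¹' {q | ¬ E.IsGoodEstimate V ε s q.1} ⊆
      ⋃ a : Fin P.K, {w | (1 - √P.γ) * ε ≤ |(∑ k : Fin (P.N δ' ε), (w (a, k)).1) / P.N δ' ε
        - ∫ x, x.1 ∂E.sampleQ P.γ T (s, a)|} := by
    intro w hw
    contrapose! hw
    simp only [Set.mem_iUnion, Set.mem_ofPred_eq, not_exists, not_le] at hw
    exact not_not.2 (isGoodEstimate_clippedMeans h hV hlo hm fun a => (hw a).le)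
  rw [estimateQ_apply, Measure.map_apply (measurable_clippedMeans lo _) hbad]
  calc _ ≤ ∑ a : Fin P.K, _ := (measure_mono hsub).trans (measure_iUnion_fintype_le _ _)
    _ ≤ ∑ _ : Fin P.K, ENNReal.ofReal (δ' / P.K) :=
      Finset.sum_le_sum fun a _ => hT.measure_deviation_le hδ hδ' hε s a
    _ = ENNReal.ofReal δ' := by
      rw [Finset.sum_const, Finset.card_univ, Fintype.card_fin, nsmul_eq_mul,
        ← ENNReal.ofReal_natCast, ← ENNReal.ofReal_mul hK.le, mul_div_cancel₀ _ hK.ne']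

section Correction

open Classical in
/-- The estimate `q` of the `Q`-values at `s`, or the true `Q`-values if `q` is not a good
estimate. -/
noncomputable def correctEstimate (E : Env S P.K) (V : S → ℝ) (ε : ℝ)
    (p : S × (Fin P.K → ℝ)) : Fin P.K → ℝ :=
  if E.IsGoodEstimate V ε p.1 p.2 then p.2 else E.qValue P.γ V p.1

lemma measurable_correctEstimate (hV : Measurable V) : Measurable (E.correctEstimate V ε) :=
  .ite (measurableSet_isGoodEstimate hV) measurable_snd
    ((E.measurable_qValue hV).comp measurable_fst)

lemma isGoodEstimate_correctEstimate (h : E.IsSmooth P.L P.M) (hV : E.IsValue P.γ V) (hε : 0 ≤ ε)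
    (s : S) (q : Fin P.K → ℝ) : E.IsGoodEstimate V ε s (E.correctEstimate V ε (s, q)) := by
  unfold correctEstimate
  split_ifs with hq
  · exact hq
  · exact isGoodEstimate_qValue h hV hε s

/-- The procedure `G`, with the estimates that are not good replaced by the true `Q`-values. -/
noncomputable def corrected (E : Env S P.K) (V : S → ℝ) (ε : ℝ)
    (G : Kernel S ((Fin P.K → ℝ) × ℕ)) : Kernel S ((Fin P.K → ℝ) × ℕ) :=
  (Kernel.id ×ₖ G).map fun p => (E.correctEstimate V ε (p.1, p.2.1), p.2.2)

lemma measurable_corrected_out (hV : Measurable V) :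
    Measurable fun p : S × ((Fin P.K → ℝ) × ℕ) => (E.correctEstimate V ε (p.1, p.2.1), p.2.2) :=
  ((measurable_correctEstimate hV).comp (by fun_prop)).prodMk (by fun_prop)

variable (G : Kernel S ((Fin P.K → ℝ) × ℕ)) [IsMarkovKernel G]

lemma isMarkovKernel_corrected (hV : Measurable V) : IsMarkovKernel (E.corrected V ε G) :=
  Kernel.IsMarkovKernel.map _ (measurable_corrected_out hV)

lemma corrected_apply (hV : Measurable V) (s : S) :
    E.corrected V ε G s = (G s).map fun q => (E.correctEstimate V ε (s, q.1), q.2) := by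
  rw [corrected, Kernel.map_apply _ (measurable_corrected_out hV), id_prod_eq_map,
    Measure.map_map (measurable_corrected_out hV) measurable_prodMk_left]
  rfl

lemma ae_corrected_isGoodEstimate (h : E.IsSmooth P.L P.M) (hV : E.IsValue P.γ V) (hε : 0 ≤ ε)
    (s : S) : ∀ᵐ q ∂E.corrected V ε G s, E.IsGoodEstimate V ε s q.1 := by
  rw [corrected_apply G hV.measurable]
  refine (ae_map_iff (p := fun q => E.IsGoodEstimate V ε s q.1)
    ((measurable_corrected_out hV.measurable).comp measurable_prodMk_left).aemeasurable
    ((measurableSet_isGoodEstimate hV.measurable).preimage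
      (measurable_prodMk_left.comp measurable_fst))).2 ?_
  exact .of_forall fun q => isGoodEstimate_correctEstimate h hV hε s q.1

variable {G} in
lemma leUpTo_corrected (hV : Measurable V) {η : ENNReal} {s : S}
    (hG : G s {q | ¬ E.IsGoodEstimate V ε s q.1} ≤ η) : LeUpTo η (G s) (E.corrected V ε G s) := by
  have hm := (measurable_corrected_out (E := E) (ε := ε) hV).comp
    (measurable_prodMk_left (x := s))
  have := LeUpTo.of_eqOn_compl measurable_id hm
    ((measurableSet_isGoodEstimate (E := E) (ε := ε) hV).preimage
      (measurable_prodMk_left.comp measurable_fst)).compl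
    (fun q hq => Prod.ext (if_pos (not_not.1 hq)).symm rfl) hG
  rw [Measure.map_id] at this
  rwa [corrected_apply G hV]

end Correction

lemma leUpTo_corrected_estimateQ (h : E.IsSmooth P.L P.M) (hV : E.IsValue P.γ V)
    (hlo : E.ClipLevel P V lo) (hδ : 0 < δ') (hδ' : δ' < 2 * P.K) (hε : 0 < ε)
    {T T' : Kernel S (ℝ × ℕ)} [IsMarkovKernel T] [IsMarkovKernel T'] {c : ℕ}
    (hT : ∀ s, LeUpTo (ENNReal.ofReal (δ' * c)) (T s) (T' s))
    (hT' : Accurate P V (P.relax ε) T') (s : S) :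
    LeUpTo (ENNReal.ofReal (δ' * P.callsQ δ' c ε)) (estimateQ P E lo δ' T ε s)
      (E.corrected V ε (estimateQ P E lo δ' T' ε) s) := by
  have hfail := estimateQ_not_isGoodEstimate_le h hV hlo hδ hδ' hε hT' s
  refine ((E.leUpTo_estimateQ lo δ' ε hT s).trans (leUpTo_corrected hV.measurable hfail)).mono ?_
  rw [← ENNReal.ofReal_natCast, ← ENNReal.ofReal_mul (by positivity),
    ← ENNReal.ofReal_add (by positivity) hδ.le]
  refine ENNReal.ofReal_le_ofReal ?_
  have hsamples : (1 : ℝ) ≤ (P.K * P.N δ' ε : ℕ) :=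
    Nat.one_le_cast.2 (Nat.mul_pos P.K_pos (Params.N_pos hδ hδ' hε))
  calc (P.K * P.N δ' ε : ℕ) * (δ' * c) + δ'
      ≤ (P.K * P.N δ' ε : ℕ) * (δ' * c) + (P.K * P.N δ' ε : ℕ) * δ' := by nlinarith
    _ = δ' * P.callsQ δ' c ε := by
      unfold Params.callsQ
      push_cast
      ring

lemma IsGoodEstimate.abs_F_sub_le (h : E.IsSmooth P.L P.M) (hV : E.IsValue P.γ V) (hε : 0 ≤ ε)
    {s : S} {q : Fin P.K → ℝ} (hq : E.IsGoodEstimate V ε s q) : |E.F s q - V s| ≤ ε := by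
  rw [hV.bellman s]
  exact h.abs_F_sub_le s hε fun a => (hq a).1

lemma ae_evalStep_abs_sub_le (h : E.IsSmooth P.L P.M) (hV : E.IsValue P.γ V) (hε : 0 ≤ ε)
    {G : Kernel S ((Fin P.K → ℝ) × ℕ)} [IsMarkovKernel G] {s : S}
    (hG : ∀ᵐ q ∂G s, E.IsGoodEstimate V ε s q.1) : ∀ᵐ x ∂E.evalStep G s, |x.1 - V s| ≤ ε := by
  refine (ae_evalStep_iff E G (p := fun x => |x.1 - V s| ≤ ε)
    (measurableSet_le (by fun_prop) measurable_const) s).2 ?_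
  filter_upwards [hG] with q hq
  exact hq.abs_F_sub_le h hV hε

lemma accurate_zero (h : E.IsSmooth P.L P.M) (hV : E.IsValue P.γ V) (hc : P.cap ≤ ε) :
    Accurate P V ε (Kernel.const S (Measure.dirac ((0 : ℝ), (0 : ℕ)))) := by
  refine ⟨fun s => ?_, fun s => ?_⟩
  · rw [Kernel.const_apply, ae_dirac_iff (measurableSet_le measurable_fst.abs measurable_const)]
    simpa using P.range_nonneg
  · rw [Kernel.const_apply, integral_dirac]
    simpa using (hV.abs_le_cap h s).trans hc

lemma accurate_evalStep (h : E.IsSmooth P.L P.M) (hV : E.IsValue P.γ V) (hε : 0 ≤ ε)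
    {G : Kernel S ((Fin P.K → ℝ) × ℕ)} [IsMarkovKernel G]
    (hG : ∀ s, ∀ᵐ q ∂G s, E.IsGoodEstimate V ε s q.1) : Accurate P V ε (E.evalStep G) := by
  have hb (s : S) : ∀ᵐ x ∂E.evalStep G s, |x.1| ≤ P.range := by
    refine (ae_evalStep_iff E G (p := fun x => |x.1| ≤ P.range)
      (measurableSet_le measurable_fst.abs measurable_const) s).2 ?_
    filter_upwards [hG s] with q hq
    linarith [h.abs_F_le s P.cap_pos.le fun a => (hq a).2, P.one_add_le_cap,
      P.three_mul_cap_le_range, P.cap_pos]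
  exact ⟨hb, fun s => abs_integral_sub_le
    (.of_bound measurable_fst.aestronglyMeasurable P.range (hb s))
    (ae_evalStep_abs_sub_le h hV hε (hG s))⟩

lemma integral_draw (h : E.IsSmooth P.L P.M) (s : S) (q m : Fin P.K → ℝ) :
    ∫ a, E.linearized s q (m a) ∂E.draw (s, q) =
      E.F s q + ∑ a, (m a - q a) * E.grad s q a := by
  have hg := h.gradNorm_pos s q
  have hterm (a : Fin P.K) : E.grad s q a / E.gradNorm s q * E.linearized s q (m a) =
      (E.F s q - ∑ b, q b * E.grad s q b) / E.gradNorm s q * E.grad s q a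
        + m a * E.grad s q a := by
    unfold linearized
    field_simp
  have hsum := integral_sum_dirac (p := fun a => E.grad s q a / E.gradNorm s q)
    (fun a => div_nonneg (h.grad_nonneg s q a) hg.le) fun a => E.linearized s q (m a)
  refine Eq.trans hsum ?_
  simp_rw [hterm, sub_mul]
  rw [Finset.sum_add_distrib, ← Finset.mul_sum, ← h.gradNorm_eq, div_mul_cancel₀ _ hg.ne',
    Finset.sum_sub_distrib]
  ring

lemma abs_linearized_le (h : E.IsSmooth P.L P.M) {s : S} {q : Fin P.K → ℝ}
    (hq : E.IsGoodEstimate V ε s q) {y : ℝ} (hy : |y| ≤ 1 + P.γ * P.range) :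
    |E.linearized s q y| ≤ P.range := by
  have hgrad : |y * E.gradNorm s q| ≤ |y| := by
    rw [abs_mul, abs_of_pos (h.gradNorm_pos s q)]
    exact mul_le_of_le_one_right (abs_nonneg _) (h.gradNorm_le s q)
  calc |E.linearized s q y|
      ≤ |E.F s q| + |∑ a, q a * E.grad s q a| + |y * E.gradNorm s q| :=
        (abs_add_le _ _).trans (add_le_add (abs_sub _ _) le_rfl)
    _ ≤ (P.M + P.cap) + P.cap + (1 + P.γ * P.range) := by
        gcongr
        · linarith [h.abs_F_le s P.cap_pos.le fun a => (hq a).2]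
        · exact h.abs_sum_mul_grad_le s q P.cap_pos.le fun a => (hq a).2
        · exact hgrad.trans hy
    _ ≤ P.range := by linarith [P.range_eq, P.one_add_le_cap]

-- With an error of `√(κ ε)` in each entry, the choice of `κ` makes the quadratic error of the
-- linearization at most `(1 - √γ) ε`; the error of the linear part is at most `√γ ε`.
lemma IsGoodEstimate.abs_F_add_sum_sub_le (h : E.IsSmooth P.L P.M) (hV : E.IsValue P.γ V)
    (hε : 0 ≤ ε) {s : S} {q m : Fin P.K → ℝ} (hq : E.IsGoodEstimate V √(P.kappa * ε) s q)
    (hm : ∀ a, |m a - E.qValue P.γ V s a| ≤ √P.γ * ε) :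
    |E.F s q + ∑ a, (m a - q a) * E.grad s q a - V s| ≤ ε := by
  rw [hV.bellman s]
  set Q := E.qValue P.γ V s
  have hK : (0 : ℝ) < P.K := Nat.cast_pos.2 P.K_pos
  have hL := P.L_pos
  have hκ := P.kappa_pos
  have quadratic : |E.F s Q - E.F s q - ∑ a, (Q a - q a) * E.grad s q a| ≤ (1 - √P.γ) * ε :=
    calc _ ≤ P.L * ∑ a, (Q a - q a) ^ 2 := h.smooth s Q q
      _ ≤ P.L * ∑ _ : Fin P.K, √(P.kappa * ε) ^ 2 := by
          refine mul_le_mul_of_nonneg_left (Finset.sum_le_sum fun a _ => ?_) hL.le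
          rw [← sq_abs, abs_sub_comm]
          exact pow_le_pow_left₀ (abs_nonneg _) (hq a).1 2
      _ = (1 - √P.γ) * ε := by
          rw [Real.sq_sqrt (by positivity), Finset.sum_const, Finset.card_univ, Fintype.card_fin,
            nsmul_eq_mul, Params.kappa]
          field_simp
  have linear : |∑ a, (m a - Q a) * E.grad s q a| ≤ √P.γ * ε :=
    h.abs_sum_mul_grad_le s q (by positivity) hm
  simp only [sub_mul, Finset.sum_sub_distrib] at quadratic linear ⊢
  rw [abs_le] at quadratic linear ⊢
  constructor <;> linarith

section LinStep

variable {G : Kernel S ((Fin P.K → ℝ) × ℕ)} [IsMarkovKernel G] {T : Kernel S (ℝ × ℕ)}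
  [IsMarkovKernel T]

lemma ae_linStep_abs_le (h : E.IsSmooth P.L P.M) {e : ℝ} {s : S}
    (hG : ∀ᵐ q ∂G s, E.IsGoodEstimate V e s q.1) (hT : Accurate P V ε T) :
    ∀ᵐ x ∂E.linStep G (E.sampleQ P.γ T) s, |x.1| ≤ P.range := by
  refine ae_linStep E G _ (p := fun x => |x.1| ≤ P.range)
    (measurableSet_le measurable_fst.abs measurable_const) ?_
  filter_upwards [hG] with q hq a
  filter_upwards [hT.ae_sampleQ_mem_Icc (E := E) (s, a)] with v hv
  exact abs_linearized_le h hq (abs_le.2 ⟨by linarith [hv.1], hv.2⟩)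

lemma integral_linStep_eq (h : E.IsSmooth P.L P.M) [IsMarkovKernel E.draw] {e : ℝ}
    {s : S} (hG : ∀ᵐ q ∂G s, E.IsGoodEstimate V e s q.1) (hT : Accurate P V ε T) :
    ∫ x, x.1 ∂E.linStep G (E.sampleQ P.γ T) s =
      ∫ q, (E.F s q.1 + ∑ a, (∫ x, x.1 ∂E.sampleQ P.γ T (s, a) - q.1 a) * E.grad s q.1 a) ∂G s := by
  rw [integral_linStep E G _ measurable_fst
    (.of_bound measurable_fst.aestronglyMeasurable P.range (ae_linStep_abs_le h hG hT))]
  refine integral_congr_ae (.of_forall fun q => ?_)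
  simp only
  rw [← integral_draw h]
  refine integral_congr_ae (.of_forall fun a => ?_)
  simp only [linearized]
  rw [integral_add (integrable_const _) ((hT.integrable_sampleQ _).mul_const _),
    integral_mul_const]
  simp

lemma accurate_linStep (h : E.IsSmooth P.L P.M) (hV : E.IsValue P.γ V) (hε : 0 ≤ ε)
    [IsMarkovKernel E.draw] (hG : ∀ s, ∀ᵐ q ∂G s, E.IsGoodEstimate V √(P.kappa * ε) s q.1)
    (hT : Accurate P V (P.relax ε) T) : Accurate P V ε (E.linStep G (E.sampleQ P.γ T)) := by
  refine ⟨fun s => ae_linStep_abs_le h (hG s) hT, fun s => ?_⟩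
  set m : Fin P.K → ℝ := fun a => ∫ x, x.1 ∂E.sampleQ P.γ T (s, a)
  have hm (a : Fin P.K) : |m a - E.qValue P.γ V s a| ≤ √P.γ * ε := by
    rw [← P.gamma_mul_relax]
    exact hT.abs_integral_sampleQ_sub_le hV.measurable (hV.abs_le_cap h) s a
  have hgood : ∀ᵐ q ∂G s, |E.F s q.1 + ∑ a, (m a - q.1 a) * E.grad s q.1 a - V s| ≤ ε :=
    (hG s).mono fun q hq => hq.abs_F_add_sum_sub_le h hV hε hm
  have hmeas : Measurable fun q : (Fin P.K → ℝ) × ℕ =>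
      E.F s q.1 + ∑ a, (m a - q.1 a) * E.grad s q.1 a := by fun_prop
  rw [integral_linStep_eq h (hG s) hT]
  refine abs_integral_sub_le (.of_bound hmeas.aestronglyMeasurable (P.cap + ε) ?_) hgood
  filter_upwards [hgood] with q hq
  have := norm_add_le (V s) (E.F s q.1 + ∑ a, (m a - q.1 a) * E.grad s q.1 a - V s)
  rw [add_sub_cancel] at this
  exact this.trans (add_le_add (hV.abs_le_cap h s) hq)

end LinStep

lemma exists_accurate_leUpTo_sampleV (h : E.IsSmooth P.L P.M) (hV : E.IsValue P.γ V)
    (hlo : E.ClipLevel P V lo) (hδ : 0 < δ') (hδ' : δ' < 2 * P.K) (hε : 0 < ε) :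
    ∃ T : Kernel S (ℝ × ℕ), IsMarkovKernel T ∧
      (∀ s, LeUpTo (ENNReal.ofReal (δ' * P.callsV δ' ε)) (sampleV P E lo δ' ε s) (T s)) ∧
      Accurate P V ε T := by
  have hdraw := h.isMarkovKernel_draw
  refine P.accuracy_induction (p := fun ε => ∃ T : Kernel S (ℝ × ℕ), IsMarkovKernel T ∧
      (∀ s, LeUpTo (ENNReal.ofReal (δ' * P.callsV δ' ε)) (sampleV P E lo δ' ε s) (T s)) ∧
      Accurate P V ε T)
    (fun ε hc => ?_) (fun ε hε hc hk ih => ?_) (fun ε hε hc hk ih ih' => ?_) hε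
  · refine ⟨_, inferInstance, fun s => ?_, accurate_zero h hV hc⟩
    rw [sampleV_of_cap_le E lo δ' hc]
    exact .refl _ _
  · obtain ⟨T, _, hTV, hT⟩ := ih
    have := E.isMarkovKernel_sampleV lo δ' (P.relax_pos hε)
    have := isMarkovKernel_corrected (E := E) (ε := ε) (estimateQ P E lo δ' T ε) hV.measurable
    refine ⟨E.evalStep (E.corrected V ε (estimateQ P E lo δ' T ε)), inferInstance, fun s => ?_,
      accurate_evalStep h hV hε.le (ae_corrected_isGoodEstimate _ h hV hε.le)⟩
    rw [sampleV_of_kappa_le E lo δ' hε hc hk, Params.callsV_of_kappa_le δ' hε hc hk]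
    exact E.leUpTo_evalStep (leUpTo_corrected_estimateQ h hV hlo hδ hδ' hε hTV hT s)
  · obtain ⟨T, _, hTV, hT⟩ := ih
    obtain ⟨T', _, hTV', hT'⟩ := ih'
    have he : 0 < √(P.kappa * ε) := Real.sqrt_pos.2 (mul_pos P.kappa_pos hε)
    have := E.isMarkovKernel_sampleV lo δ' (P.relax_pos hε)
    have := E.isMarkovKernel_sampleV lo δ' (P.relax_pos he)
    set G := E.corrected V √(P.kappa * ε) (estimateQ P E lo δ' T √(P.kappa * ε))
    have : IsMarkovKernel G := isMarkovKernel_corrected _ hV.measurable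
    refine ⟨E.linStep G (E.sampleQ P.γ T'), inferInstance, fun s => ?_,
      accurate_linStep h hV hε.le (ae_corrected_isGoodEstimate _ h hV he.le) hT'⟩
    rw [sampleV_of_lt_kappa E lo δ' hε hc hk, Params.callsV_of_lt_kappa δ' hε hc hk]
    refine (E.leUpTo_linStep (leUpTo_corrected_estimateQ h hV hlo hδ hδ' he hTV hT s)
      fun p => E.leUpTo_sampleQ P.γ hTV' p).mono ?_
    rw [← ENNReal.ofReal_add (by positivity) (by positivity)]
    refine ENNReal.ofReal_le_ofReal ?_
    push_cast
    linarith

lemma smoothCruiser_error_le (h : E.IsSmooth P.L P.M) (hV : E.IsValue P.γ V)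
    (hlo : E.ClipLevel P V lo) (hδ : 0 < δ') (hδ' : δ' < 2 * P.K) (hε : 0 < ε) (s : S) :
    smoothCruiser P E lo δ' ε s {o | ε < |o.1 - V s|} ≤
      ENNReal.ofReal (δ' * P.calls ε δ') := by
  have hdraw := h.isMarkovKernel_draw
  obtain ⟨T, _, hTV, hT⟩ := exists_accurate_leUpTo_sampleV h hV hlo hδ hδ' (P.relax_pos hε)
  have := E.isMarkovKernel_sampleV lo δ' (P.relax_pos hε)
  set G := E.corrected V ε (estimateQ P E lo δ' T ε)
  have : IsMarkovKernel G := isMarkovKernel_corrected _ hV.measurable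
  have hexact : E.evalStep G s {o | ε < |o.1 - V s|} = 0 := by
    simpa only [ae_iff, not_le] using
      ae_evalStep_abs_sub_le h hV hε.le (ae_corrected_isGoodEstimate _ h hV hε.le s)
  have hle := (E.leUpTo_evalStep
    (leUpTo_corrected_estimateQ h hV hlo hδ hδ' hε hTV hT s)).measure_le
      (A := {o | ε < |o.1 - V s|}) (measurableSet_lt measurable_const (by fun_prop))
  rwa [hexact, zero_add] at hle

end Env

/-! ## Sample complexity -/

lemma add_one_le_mul_exp {s x : ℝ} (hs : 0 < s) (hx : 0 ≤ x) :
    x + 1 ≤ (1 + 1 / s) * Real.exp (s * x) := by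
  have hlin : x ≤ 1 / s * Real.exp (s * x) := by
    rw [one_div, inv_mul_eq_div, le_div_iff₀ hs]
    linarith [Real.add_one_le_exp (s * x)]
  linarith [Real.one_le_exp (mul_nonneg hs.le hx)]

section Growth

/-- The bound on the number of oracle calls of `sampleV` at an accuracy `m ≤ 1`, up to a constant,
with `ℓ = log (2K / δ')`. The number of samples costs a factor of order `ℓ` in each of the
`log log (1 / m)` many calls at a new scale `√(κ m)`; the growing negative part `-η ℓ m ^ s` of the
exponent absorbs these factors one by one. -/
noncomputable def growth (s η ℓ m : ℝ) : ℝ :=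
  m ^ (-(2 + 4 * s)) * Real.exp (η * ℓ * (2 - m ^ s))

variable {s η ℓ m : ℝ}

lemma growth_le_growth (hs : 0 < s) (hη : 0 < η) (hℓ : 0 ≤ ℓ) (hm : 0 < m) {m' : ℝ}
    (h : m ≤ m') : growth s η ℓ m' ≤ growth s η ℓ m := by
  have hpow : m' ^ (-(2 + 4 * s)) ≤ m ^ (-(2 + 4 * s)) :=
    Real.rpow_le_rpow_of_nonpos hm h (by linarith)
  have hexp : m ^ s ≤ m' ^ s := Real.rpow_le_rpow hm.le h hs.le
  unfold growth
  gcongr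

lemma exp_le_growth (hs : 0 < s) (hη : 0 < η) (hℓ : 0 ≤ ℓ) (hm : 0 < m) (hm1 : m ≤ 1) :
    Real.exp (η * ℓ) ≤ growth s η ℓ m := by
  have := growth_le_growth hs hη hℓ hm hm1
  norm_num [growth] at this ⊢
  exact this

lemma growth_le_rpow_mul_exp (hη : 0 < η) (hℓ : 0 ≤ ℓ) (hm : 0 < m) :
    growth s η ℓ m ≤ m ^ (-(2 + 4 * s)) * Real.exp (2 * η * ℓ) := by
  refine mul_le_mul_of_nonneg_left (Real.exp_le_exp.2 ?_) (by positivity)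
  nlinarith [mul_nonneg (mul_nonneg hη.le hℓ) (Real.rpow_nonneg hm.le s)]

lemma growth_mul_le (hs : 0 < s) (hη : 0 < η) (hℓ : 0 ≤ ℓ) (hm : 0 < m) {r : ℝ} (hr : 1 ≤ r) :
    growth s η ℓ (r * m) ≤ r⁻¹ * growth s η ℓ m := by
  have hr0 : 0 < r := one_pos.trans_le hr
  have hpow : r ^ (-(2 + 4 * s)) ≤ r⁻¹ := by
    rw [← Real.rpow_neg_one]
    exact Real.rpow_le_rpow_of_exponent_le hr (by linarith)
  have hexp : m ^ s ≤ (r * m) ^ s := Real.rpow_le_rpow hm.le (by nlinarith) hs.le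
  unfold growth
  rw [Real.mul_rpow hr0.le hm.le, ← mul_assoc]
  gcongr

lemma growth_sqrt_le (hη : 0 < η) (hℓ : 0 ≤ ℓ) (hs : 0 < s) {κ : ℝ} (hκ : 0 < κ) (hm : 0 < m)
    (hm1 : m ≤ 1) (hsmall : 2 * m ^ s ≤ √(κ * m) ^ s) :
    (ℓ + 1) / m * growth s η ℓ √(κ * m) ≤
      κ ^ (-(1 + 2 * s)) * (1 + 1 / η) * m ^ s * growth s η ℓ m := by
  have hms1 : m ^ s ≤ 1 := Real.rpow_le_one hm.le hm1 hs.le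
  have hsqrt : √(κ * m) ^ (-(2 + 4 * s)) = κ ^ (-(1 + 2 * s)) * m ^ (-(1 + 2 * s)) := by
    rw [Real.sqrt_eq_rpow, ← Real.rpow_mul (by positivity), Real.mul_rpow hκ.le hm.le]
    ring_nf
  have hpow : m ^ (-(1 + 2 * s)) / m = m ^ (-(2 + 4 * s)) * m ^ s * m ^ s := by
    rw [div_eq_mul_inv, ← Real.rpow_neg_one m]
    simp only [← Real.rpow_add hm]
    ring_nf
  have hlog : (ℓ + 1) * m ^ s ≤ (1 + 1 / η) * Real.exp (η * (m ^ s * ℓ)) := by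
    refine le_trans ?_ (add_one_le_mul_exp hη (by positivity))
    linarith
  have hexp : (ℓ + 1) * m ^ s * Real.exp (η * ℓ * (2 - √(κ * m) ^ s)) ≤
      (1 + 1 / η) * Real.exp (η * ℓ * (2 - m ^ s)) := by
    calc _ ≤ (1 + 1 / η) * Real.exp (η * (m ^ s * ℓ)) *
          Real.exp (η * ℓ * (2 - 2 * m ^ s)) := by gcongr
      _ = _ := by
        rw [mul_assoc, ← Real.exp_add]
        ring_nf
  unfold growth
  rw [hsqrt]
  calc _ = κ ^ (-(1 + 2 * s)) * (ℓ + 1) * (m ^ (-(1 + 2 * s)) / m)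
        * Real.exp (η * ℓ * (2 - √(κ * m) ^ s)) := by ring
    _ = κ ^ (-(1 + 2 * s)) * m ^ s * m ^ (-(2 + 4 * s))
        * ((ℓ + 1) * m ^ s * Real.exp (η * ℓ * (2 - √(κ * m) ^ s))) := by rw [hpow]; ring
    _ ≤ κ ^ (-(1 + 2 * s)) * m ^ s * m ^ (-(2 + 4 * s))
        * ((1 + 1 / η) * Real.exp (η * ℓ * (2 - m ^ s))) := by gcongr
    _ = _ := by ring

lemma tendsto_rpow_nhdsGT_zero (hs : 0 < s) : Tendsto (fun m : ℝ => m ^ s) (𝓝[>] 0) (𝓝 0) := by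
  have := (Real.continuousAt_rpow_const 0 s (Or.inr hs.le)).tendsto
  rw [Real.zero_rpow hs.ne'] at this
  exact this.mono_left nhdsWithin_le_nhds

lemma eventually_growth_sqrt_le (hs : 0 < s) (hη : 0 < η) {κ θ B : ℝ} (hκ : 0 < κ) (hθ : 0 < θ)
    (hB : 0 ≤ B) : ∀ᶠ m in 𝓝[>] 0, ∀ ℓ, 0 ≤ ℓ →
      B * (ℓ + 1) / m * growth s η ℓ √(κ * m) ≤ θ * growth s η ℓ m := by
  have hs2 : 0 < s / 2 := half_pos hs
  have hconst : ∀ᶠ m : ℝ in 𝓝[>] 0, B * (κ ^ (-(1 + 2 * s)) * (1 + 1 / η)) * m ^ s < θ :=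
    ((tendsto_rpow_nhdsGT_zero hs).const_mul _).eventually_lt_const (by simpa using hθ)
  have hhalf : ∀ᶠ m : ℝ in 𝓝[>] 0, 2 * m ^ (s / 2) < κ ^ (s / 2) :=
    ((tendsto_rpow_nhdsGT_zero hs2).const_mul 2).eventually_lt_const
      (by simpa using Real.rpow_pos_of_pos hκ _)
  filter_upwards [self_mem_nhdsWithin, Ioo_mem_nhdsGT one_pos, hconst, hhalf]
    with m (hm : 0 < m) hm1 hconst hhalf ℓ hℓ
  have hsmall : 2 * m ^ s ≤ √(κ * m) ^ s := by
    have hpow : m ^ s = m ^ (s / 2) * m ^ (s / 2) := by rw [← Real.rpow_add hm, add_halves]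
    have hsqrt : √(κ * m) ^ s = κ ^ (s / 2) * m ^ (s / 2) := by
      rw [Real.sqrt_eq_rpow, ← Real.rpow_mul (by positivity), Real.mul_rpow hκ.le hm.le]
      ring_nf
    rw [hpow, hsqrt, ← mul_assoc]
    gcongr
  have hg : 0 ≤ growth s η ℓ m := by unfold growth; positivity
  calc B * (ℓ + 1) / m * growth s η ℓ √(κ * m)
      = B * ((ℓ + 1) / m * growth s η ℓ √(κ * m)) := by ring
    _ ≤ B * (κ ^ (-(1 + 2 * s)) * (1 + 1 / η) * m ^ s * growth s η ℓ m) := by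
        have := growth_sqrt_le hη hℓ hs hκ hm hm1.2.le hsmall
        gcongr
    _ = B * (κ ^ (-(1 + 2 * s)) * (1 + 1 / η)) * m ^ s * growth s η ℓ m := by ring
    _ ≤ θ * growth s η ℓ m := by gcongr

end Growth

namespace Params

variable (P : Params)

/-- The factor in the bound on the number of samples per action. -/
noncomputable def sampleFactor : ℝ :=
  18 * (1 + P.M) ^ 2 / ((1 - P.γ) ^ 4 * (1 - √P.γ) ^ 2) + 1

lemma sampleFactor_pos : 0 < P.sampleFactor := by
  unfold sampleFactor
  positivity

lemma K_cast_pos : (0 : ℝ) < P.K := Nat.cast_pos.2 P.K_pos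

/-- A factor above one by which the accuracy grows in a recursive call. -/
noncomputable def ratio : ℝ := 2 / (1 + √P.γ)

lemma one_lt_ratio : 1 < P.ratio := by
  rw [ratio, one_lt_div (by positivity)]
  linarith [P.sqrt_lt_one]

lemma ratio_le_two : P.ratio ≤ 2 :=
  div_le_self zero_le_two (by linarith [Real.sqrt_nonneg P.γ])

variable {P} {δ' ε m s η : ℝ}

lemma le_relax (hε : 0 < ε) (hm : m ≤ P.ratio * ε) (hc : m ≤ P.cap) : m ≤ P.relax ε := by
  unfold relax
  split_ifs with h
  · exact hc
  · have hγ : 0 < √P.γ := Real.sqrt_pos.2 (lt_of_le_of_ne P.γ_nonneg (Ne.symm h))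
    refine hm.trans ?_
    rw [ratio, div_mul_eq_mul_div, div_le_div_iff₀ (by linarith) hγ]
    nlinarith [P.sqrt_lt_one]

lemma le_relax_of_le_one (hε : 0 < ε) (hm : m ≤ ε) (hm1 : m ≤ 1) : m ≤ P.relax ε :=
  le_relax hε (by nlinarith [P.one_lt_ratio]) (hm1.trans P.one_le_cap)

lemma log_nonneg_of_lt (hδ : 0 < δ') (hδ' : δ' < 2 * P.K) : 0 ≤ Real.log (2 * P.K / δ') :=
  Real.log_nonneg ((one_le_div hδ).2 hδ'.le)

lemma N_le (hl : 0 ≤ Real.log (2 * P.K / δ')) (hm : 0 < m) (hm1 : m ≤ 1) (hmε : m ≤ ε) :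
    (P.N δ' ε : ℝ) ≤ P.sampleFactor * (Real.log (2 * P.K / δ') + 1) / m ^ 2 := by
  have hε : 0 < ε := hm.trans_le hmε
  unfold N sampleFactor
  set ℓ := Real.log (2 * P.K / δ')
  set A := 18 * (1 + P.M) ^ 2 / ((1 - P.γ) ^ 4 * (1 - √P.γ) ^ 2)
  have hA : 0 ≤ A := by positivity
  have hm2 : m ^ 2 ≤ 1 := pow_le_one₀ hm.le hm1
  calc (⌈A * (ℓ / ε ^ 2)⌉₊ : ℝ) ≤ A * (ℓ / ε ^ 2) + 1 :=
        (Nat.ceil_lt_add_one (by positivity)).le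
    _ ≤ A * (ℓ / m ^ 2) + 1 := by gcongr
    _ = (A * ℓ + m ^ 2) / m ^ 2 := by field_simp
    _ ≤ (A + 1) * (ℓ + 1) / m ^ 2 := by
      gcongr
      nlinarith

lemma N_le_exp (hη : 0 < η) (hl : 0 ≤ Real.log (2 * P.K / δ')) (hm : 0 < m) (hm1 : m ≤ 1)
    (hmε : m ≤ ε) : (P.N δ' ε : ℝ) ≤
      P.sampleFactor * (1 + 1 / η) / m ^ 2 * Real.exp (η * Real.log (2 * P.K / δ')) := by
  have hA := P.sampleFactor_pos
  calc (P.N δ' ε : ℝ) ≤ P.sampleFactor * (Real.log (2 * P.K / δ') + 1) / m ^ 2 :=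
        N_le hl hm hm1 hmε
    _ ≤ P.sampleFactor * ((1 + 1 / η) * Real.exp (η * Real.log (2 * P.K / δ'))) / m ^ 2 := by
        gcongr
        exact add_one_le_mul_exp hη hl
    _ = _ := by ring

lemma callsV_add_one_of_lt_kappa (hε : 0 < ε) (hc : ε < P.cap) (hk : ε < P.kappa) :
    (P.callsV δ' ε + 1 : ℝ) = P.K * P.N δ' √(P.kappa * ε) *
      (P.callsV δ' (P.relax √(P.kappa * ε)) + 1) + 1 + (P.callsV δ' (P.relax ε) + 1) := by
  rw [callsV_of_lt_kappa δ' hε hc hk, callsQ]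
  push_cast
  ring

lemma exists_callsV_add_one_le (δ' : ℝ) (hε : 0 < ε) : ∃ e, ε ≤ e ∧
    (P.callsV δ' ε + 1 : ℝ) ≤
      P.K * P.N δ' e * (P.callsV δ' (P.relax e) + 1) + 1 + (P.callsV δ' (P.relax ε) + 1) := by
  rcases le_or_gt P.cap ε with hc | hc
  · refine ⟨ε, le_rfl, ?_⟩
    rw [callsV_of_cap_le δ' hc, Nat.cast_zero, zero_add, add_right_comm]
    exact le_add_of_nonneg_left (by positivity)
  rcases le_or_gt P.kappa ε with hk | hk
  · refine ⟨ε, le_rfl, ?_⟩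
    rw [callsV_of_kappa_le δ' hε hc hk, callsQ]
    push_cast
    linarith [(P.callsV δ' (P.relax ε)).cast_nonneg (α := ℝ)]
  · exact ⟨_, P.le_sqrt_kappa hε hk, (callsV_add_one_of_lt_kappa hε hc hk).le⟩

lemma callsV_le_exp_of_relax_le (hη : 0 < η) (hl : 0 ≤ Real.log (2 * P.K / δ')) (hm : 0 < m)
    (hm1 : m ≤ 1) (hmε : m ≤ ε) {D : ℝ} (hrec : ∀ e, ε ≤ e →
      (P.callsV δ' (P.relax e) + 1 : ℝ) ≤ D * Real.exp (η * Real.log (2 * P.K / δ'))) :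
    (P.callsV δ' ε + 1 : ℝ) ≤ (P.K * (P.sampleFactor * (1 + 1 / η) / m ^ 2) * D + 1 + D) *
      Real.exp (2 * η * Real.log (2 * P.K / δ')) := by
  have hA := P.sampleFactor_pos
  obtain ⟨e, he, hstep⟩ := exists_callsV_add_one_le δ' (hm.trans_le hmε)
  have hN := N_le_exp hη hl hm hm1 (hmε.trans he)
  set ℓ := Real.log (2 * P.K / δ')
  set X := Real.exp (η * ℓ)
  have hX1 : 1 ≤ X := Real.one_le_exp (by positivity)
  have hXX : X ≤ X * X := le_mul_of_one_le_right (by positivity) hX1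
  have hD : 0 ≤ D := nonneg_of_mul_nonneg_left
    (le_trans (by positivity) (hrec ε le_rfl)) (Real.exp_pos _)
  refine hstep.trans ?_
  calc _ ≤ P.K * (P.sampleFactor * (1 + 1 / η) / m ^ 2 * X) * (D * X) + 1 + D * X := by
        gcongr
        · exact hrec e he
        · exact hrec ε le_rfl
    _ = P.K * (P.sampleFactor * (1 + 1 / η) / m ^ 2) * D * (X * X) + 1 + D * X := by ring
    _ ≤ P.K * (P.sampleFactor * (1 + 1 / η) / m ^ 2) * D * (X * X) + X * X + D * (X * X) := by
        gcongr
        exact hX1.trans hXX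
    _ = (P.K * (P.sampleFactor * (1 + 1 / η) / m ^ 2) * D + 1 + D) * Real.exp (2 * η * ℓ) := by
        rw [mul_assoc 2, two_mul, Real.exp_add]
        ring

-- Each level of the recursion costs a factor of order `ℓ = log (2K / δ')`; allowing it only half
-- of the exponent `η` leaves the other half for that factor.
lemma exists_callsV_le_exp_of_cap_le (hm : 0 < m) (hm1 : m ≤ 1) (d : ℕ) :
    ∀ η, 0 < η → ∃ D, ∀ δ', 0 ≤ Real.log (2 * P.K / δ') →
      ∀ ε, m ≤ ε → P.cap ≤ P.ratio ^ d * ε →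
        (P.callsV δ' ε + 1 : ℝ) ≤ D * Real.exp (η * Real.log (2 * P.K / δ')) := by
  have hρ := P.one_lt_ratio
  induction d with
  | zero =>
    refine fun η hη => ⟨1, fun δ' hl ε _ hc => ?_⟩
    rw [callsV_of_cap_le δ' (by simpa using hc)]
    simpa using mul_nonneg hη.le hl
  | succ d ih =>
    intro η hη
    obtain ⟨D, hbound⟩ := ih (η / 2) (half_pos hη)
    refine ⟨P.K * (P.sampleFactor * (1 + 1 / (η / 2)) / m ^ 2) * D + 1 + D,
      fun δ' hl ε hmε hd => ?_⟩
    have hstep := callsV_le_exp_of_relax_le (D := D) (half_pos hη) hl hm hm1 hmε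
    rw [mul_div_cancel₀ η two_ne_zero] at hstep
    refine hstep fun e he => ?_
    have he0 : 0 < e := hm.trans_le (hmε.trans he)
    refine hbound δ' hl _ (le_relax_of_le_one he0 (hmε.trans he) hm1) ?_
    rw [← div_le_iff₀' (by positivity)]
    refine le_relax he0 ?_ (div_le_self P.cap_pos.le (one_le_pow₀ hρ.le))
    rw [div_le_iff₀' (by positivity), ← mul_assoc, ← pow_succ]
    exact hd.trans (by gcongr)

lemma exists_callsV_le_exp (P : Params) (hm : 0 < m) (hm1 : m ≤ 1) (hη : 0 < η) :
    ∃ D, ∀ δ', 0 ≤ Real.log (2 * P.K / δ') → ∀ ε, m ≤ ε →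
      (P.callsV δ' ε + 1 : ℝ) ≤ D * Real.exp (η * Real.log (2 * P.K / δ')) := by
  obtain ⟨d, hd⟩ := pow_unbounded_of_one_lt (P.cap / m) P.one_lt_ratio
  obtain ⟨D, h⟩ := exists_callsV_le_exp_of_cap_le (P := P) hm hm1 d η hη
  refine ⟨D, fun δ' hl ε hε => h δ' hl ε hε ?_⟩
  have hρ := P.one_lt_ratio
  calc P.cap ≤ P.ratio ^ d * m := ((div_lt_iff₀ hm).1 hd).le
    _ ≤ P.ratio ^ d * ε := by gcongr

lemma mul_N_sqrt_le (hl : 0 ≤ Real.log (2 * P.K / δ')) (hε : 0 < ε) (h : P.kappa * ε ≤ 1) :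
    P.K * P.N δ' √(P.kappa * ε) ≤
      P.K * P.sampleFactor / P.kappa * (Real.log (2 * P.K / δ') + 1) / ε := by
  have hκ := P.kappa_pos
  have hN := N_le (P := P) hl (Real.sqrt_pos.2 (mul_pos hκ hε)) (Real.sqrt_le_one.2 h) le_rfl
  rw [Real.sq_sqrt (by positivity)] at hN
  calc _ ≤ P.K * (P.sampleFactor * (Real.log (2 * P.K / δ') + 1) / (P.kappa * ε)) := by gcongr
    _ = _ := by field_simp

lemma exists_eventually_callsV_le_growth (P : Params) (hs : 0 < s) (hη : 0 < η) :
    ∃ D₀, 0 < D₀ ∧ ∀ᶠ ε in 𝓝[>] 0, ∀ δ' D, 0 ≤ Real.log (2 * P.K / δ') → D₀ ≤ D →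
      (P.callsV δ' (P.relax √(P.kappa * ε)) + 1 : ℝ) ≤
        D * growth s η (Real.log (2 * P.K / δ')) √(P.kappa * ε) →
      (P.callsV δ' (P.relax ε) + 1 : ℝ) ≤
        D * growth s η (Real.log (2 * P.K / δ')) (P.ratio * ε) →
      (P.callsV δ' ε + 1 : ℝ) ≤ D * growth s η (Real.log (2 * P.K / δ')) ε := by
  have hκ := P.kappa_pos
  have hK := P.K_cast_pos
  have hA := P.sampleFactor_pos
  obtain ⟨θ, hθ, hθρ⟩ : ∃ θ, 0 < θ ∧ θ + θ + P.ratio⁻¹ = 1 :=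
    ⟨(1 - P.ratio⁻¹) / 2, half_pos (sub_pos.2 (inv_lt_one_of_one_lt₀ P.one_lt_ratio)), by ring⟩
  refine ⟨θ⁻¹, inv_pos.2 hθ, ?_⟩
  filter_upwards [eventually_growth_sqrt_le hs hη hκ hθ
    (B := P.K * P.sampleFactor / P.kappa) (by positivity), self_mem_nhdsWithin,
    Ioo_mem_nhdsGT (lt_min (lt_min one_pos hκ) (inv_pos.2 hκ))]
    with ε hsqrt (hε : 0 < ε) hsmall δ' D hl hD ih ih'
  obtain ⟨⟨hε1, hεκ⟩, hεκi⟩ : (ε < 1 ∧ ε < P.kappa) ∧ ε < P.kappa⁻¹ := by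
    simpa only [lt_min_iff] using hsmall.2
  have hD0 : 0 < D := (inv_pos.2 hθ).trans_le hD
  set ℓ := Real.log (2 * P.K / δ')
  have hN := mul_N_sqrt_le hl hε ((le_inv_mul_iff₀ hκ).1 (by simpa using hεκi.le))
  have estimate : P.K * P.N δ' √(P.kappa * ε) * (P.callsV δ' (P.relax √(P.kappa * ε)) + 1 : ℝ) ≤
      D * (θ * growth s η ℓ ε) :=
    calc _ ≤ P.K * P.sampleFactor / P.kappa * (ℓ + 1) / ε *
          (D * growth s η ℓ √(P.kappa * ε)) := by gcongr
      _ = D * (P.K * P.sampleFactor / P.kappa * (ℓ + 1) / ε * growth s η ℓ √(P.kappa * ε)) := by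
          ring
      _ ≤ _ := mul_le_mul_of_nonneg_left (hsqrt ℓ hl) hD0.le
  have one_call : 1 ≤ D * (θ * growth s η ℓ ε) := by
    rw [← mul_assoc]
    exact one_le_mul_of_one_le_of_one_le ((inv_le_iff_one_le_mul₀ hθ).1 hD)
      ((Real.one_le_exp (by positivity)).trans (exp_le_growth hs hη hl hε hε1.le))
  have continuation : (P.callsV δ' (P.relax ε) + 1 : ℝ) ≤ D * (P.ratio⁻¹ * growth s η ℓ ε) :=
    ih'.trans (mul_le_mul_of_nonneg_left (growth_mul_le hs hη hl hε P.one_lt_ratio.le) hD0.le)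
  rw [callsV_add_one_of_lt_kappa hε (hε1.trans_le P.one_le_cap) hεκ]
  calc _ ≤ D * (θ * growth s η ℓ ε) + D * (θ * growth s η ℓ ε)
        + D * (P.ratio⁻¹ * growth s η ℓ ε) := by linarith
    _ = D * ((θ + θ + P.ratio⁻¹) * growth s η ℓ ε) := by ring
    _ = D * growth s η ℓ ε := by rw [hθρ, one_mul]

lemma exists_callsV_le_growth (P : Params) (hs : 0 < s) (hη : 0 < η) :
    ∃ D, 0 < D ∧ ∀ δ', 0 ≤ Real.log (2 * P.K / δ') → ∀ ε m, 0 < m → m ≤ 1 → m ≤ ε →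
      (P.callsV δ' ε + 1 : ℝ) ≤ D * growth s η (Real.log (2 * P.K / δ')) m := by
  have hκ := P.kappa_pos
  obtain ⟨D₀, hD₀, hsmall⟩ := P.exists_eventually_callsV_le_growth hs hη
  obtain ⟨m₀, hm₀, hsub⟩ := mem_nhdsGT_iff_exists_Ioo_subset.1 hsmall
  obtain ⟨m₁, hm₁, hm₁₀⟩ :
      ∃ m₁, 0 < m₁ ∧ (m₁ ≤ m₀ ∧ m₁ ≤ P.kappa⁻¹) ∧ m₁ ≤ 1 / 2 ∧ m₁ ≤ P.kappa :=
    ⟨min (min m₀ P.kappa⁻¹) (min (1 / 2) P.kappa), by have : 0 < m₀ := hm₀; positivity,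
      by simp only [← le_min_iff]; exact le_rfl⟩
  obtain ⟨⟨hm₁m₀, hm₁κ⟩, hm₁half, hm₁k⟩ := hm₁₀
  obtain ⟨D₁, hlarge⟩ := P.exists_callsV_le_exp hm₁ (by linarith) hη
  refine ⟨max D₀ D₁, lt_max_of_lt_left hD₀, fun δ' hl ε m hm hm1 hmε => ?_⟩
  have hcoarse (ε : ℝ) (hε : m₁ ≤ ε) (m : ℝ) (hm : 0 < m) (hm1 : m ≤ 1) :
      (P.callsV δ' ε + 1 : ℝ) ≤ max D₀ D₁ * growth s η (Real.log (2 * P.K / δ')) m :=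
    (hlarge δ' hl ε hε).trans (mul_le_mul (le_max_right _ _) (exp_le_growth hs hη hl hm hm1)
      (Real.exp_pos _).le (hD₀.le.trans (le_max_left _ _)))
  refine P.accuracy_induction (p := fun ε => ∀ m, 0 < m → m ≤ 1 → m ≤ ε →
      (P.callsV δ' ε + 1 : ℝ) ≤ max D₀ D₁ * growth s η (Real.log (2 * P.K / δ')) m)
    (fun ε hcap m hm hm1 _ => ?_) (fun ε _ _ hk _ m hm hm1 _ => ?_)
    (fun ε hε _ _ ih ih' m hm hm1 hmε => ?_) (hm.trans_le hmε) m hm hm1 hmε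
  · exact hcoarse ε (by linarith [P.one_le_cap]) m hm hm1
  · exact hcoarse ε (hm₁k.trans hk) m hm hm1
  rcases le_or_gt m₁ ε with hε₁ | hε₁
  · exact hcoarse ε hε₁ m hm hm1
  have he : 0 < √(P.kappa * ε) := by positivity
  have he1 : √(P.kappa * ε) ≤ 1 := by
    rw [Real.sqrt_le_one, ← le_inv_mul_iff₀ hκ, mul_one]
    linarith
  have hρ1 : P.ratio * ε ≤ 1 := by nlinarith [P.ratio_le_two]
  have hρ := one_pos.trans P.one_lt_ratio
  refine (hsub ⟨hε, hε₁.trans_le hm₁m₀⟩ δ' _ hl (le_max_left _ _)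
    (ih _ he he1 (le_relax_of_le_one he le_rfl he1))
    (ih' _ (by positivity) hρ1 (le_relax hε le_rfl (hρ1.trans P.one_le_cap)))).trans ?_
  have := growth_le_growth hs hη hl hm hmε
  gcongr

lemma exists_calls_le (P : Params) {c : ℝ} (hc : 0 < c) (hη : 0 < η) :
    ∃ D, 0 < D ∧ ∀ ε δ' : ℝ, 0 < ε → 0 < δ' → δ' < 2 * P.K →
      (P.calls ε δ' : ℝ) ≤ D * (2 * P.K / δ') ^ η * (min ε 1) ^ (-(4 + c)) := by
  obtain ⟨D, hD, h⟩ := P.exists_callsV_le_growth (s := c / 4) (η := η / 3) (by positivity)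
    (by positivity)
  have hK := P.K_cast_pos
  have hA := P.sampleFactor_pos
  refine ⟨P.K * P.sampleFactor * (1 + 1 / (η / 3)) * D, by positivity,
    fun ε δ' hε hδ hδ' => ?_⟩
  have hl := log_nonneg_of_lt hδ hδ'
  have hm : 0 < min ε 1 := lt_min hε one_pos
  have hm1 : min ε 1 ≤ 1 := min_le_right _ _
  have hmε : min ε 1 ≤ ε := min_le_left _ _
  rw [Real.rpow_def_of_pos (by positivity)]
  set ℓ := Real.log (2 * P.K / δ')
  set m := min ε 1
  have samples : (P.N δ' ε : ℝ) ≤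
      P.sampleFactor * (1 + 1 / (η / 3)) / m ^ 2 * Real.exp (η / 3 * ℓ) :=
    N_le_exp (by positivity) hl hm hm1 hmε
  have recursion : (P.callsV δ' (P.relax ε) + 1 : ℝ) ≤
      D * (m ^ (-(2 + 4 * (c / 4))) * Real.exp (2 * (η / 3) * ℓ)) :=
    (h δ' hl _ m hm hm1 (le_relax_of_le_one hε hmε hm1)).trans
      (mul_le_mul_of_nonneg_left (growth_le_rpow_mul_exp (by positivity) hl hm) hD.le)
  have hpow : m ^ (-(2 + 4 * (c / 4))) / m ^ 2 = m ^ (-(4 + c)) := by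
    rw [← Real.rpow_natCast m 2, ← Real.rpow_sub hm]
    norm_num
    ring_nf
  have hexp : Real.exp (η / 3 * ℓ) * Real.exp (2 * (η / 3) * ℓ) = Real.exp (ℓ * η) := by
    rw [← Real.exp_add]
    ring_nf
  calc (P.calls ε δ' : ℝ) = P.K * P.N δ' ε * (P.callsV δ' (P.relax ε) + 1) := by
        rw [calls, callsQ]
        push_cast
        rfl
    _ ≤ P.K * (P.sampleFactor * (1 + 1 / (η / 3)) / m ^ 2 * Real.exp (η / 3 * ℓ)) *
        (D * (m ^ (-(2 + 4 * (c / 4))) * Real.exp (2 * (η / 3) * ℓ))) := by gcongr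
    _ = P.K * P.sampleFactor * (1 + 1 / (η / 3)) * D *
        (Real.exp (η / 3 * ℓ) * Real.exp (2 * (η / 3) * ℓ)) *
        (m ^ (-(2 + 4 * (c / 4))) / m ^ 2) := by ring
    _ = _ := by rw [hexp, hpow]

end Params

/-! ## The confidence parameter -/

namespace Params

variable (P : Params)

/-- The confidence parameter `δ'` for the failure probability `δ`, when `D` is a constant for which
`calls ε δ' ≤ D * √(2K / δ') / ε ^ 6`. -/
noncomputable def confidence (D ε δ : ℝ) : ℝ :=
  min 1 ((δ / D) ^ 2 / (2 * P.K)) * min ε 1 ^ 12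

variable {P} {D ε δ : ℝ}

lemma confidence_pos (hD : 0 < D) (hε : 0 < ε) (hδ : 0 < δ) : 0 < P.confidence D ε δ := by
  have hK := P.K_cast_pos
  unfold confidence
  positivity

lemma confidence_lt (hε : 0 < ε) : P.confidence D ε δ < 2 * P.K := by
  have hK : (1 : ℝ) ≤ P.K := Nat.one_le_cast.2 P.K_pos
  calc P.confidence D ε δ ≤ 1 * 1 :=
        mul_le_mul (min_le_left _ _) (pow_le_one₀ (by positivity) (min_le_right _ _))
          (by positivity) zero_le_one
    _ < 2 * P.K := by linarith

lemma confidence_mul_calls_le (hD : 0 < D) (hε : 0 < ε) (hδ : 0 < δ)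
    (h : ∀ ε δ' : ℝ, 0 < ε → 0 < δ' → δ' < 2 * P.K →
      (P.calls ε δ' : ℝ) ≤ D * (2 * P.K / δ') ^ (1 / 2 : ℝ) * (min ε 1) ^ (-(4 + 2 : ℝ))) :
    P.confidence D ε δ * P.calls ε (P.confidence D ε δ) ≤ δ := by
  have hK := P.K_cast_pos
  have hx := confidence_pos (P := P) hD hε hδ
  have hcalls := h ε _ hε hx (confidence_lt hε)
  have hm : 0 < min ε 1 := lt_min hε one_pos
  rw [← Real.sqrt_eq_rpow, show (-(4 + 2) : ℝ) = -((6 : ℕ) : ℝ) by norm_num,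
    Real.rpow_neg hm.le, Real.rpow_natCast] at hcalls
  have hsqrt : √(2 * P.K * P.confidence D ε δ) ≤ δ / D * min ε 1 ^ 6 := by
    rw [Real.sqrt_le_left (by positivity)]
    calc 2 * P.K * P.confidence D ε δ
        ≤ 2 * P.K * ((δ / D) ^ 2 / (2 * P.K) * min ε 1 ^ 12) := by
          unfold confidence
          gcongr
          exact min_le_right _ _
      _ = (δ / D * min ε 1 ^ 6) ^ 2 := by field_simp
  set x := P.confidence D ε δ
  have hmul : x * √(2 * P.K / x) = √(2 * P.K * x) := by
    rw [Real.sqrt_div (by positivity), Real.sqrt_mul (by positivity) x, mul_div_left_comm,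
      Real.div_sqrt]
  calc x * P.calls ε x ≤ x * (D * √(2 * P.K / x) * (min ε 1 ^ 6)⁻¹) := by gcongr
    _ = D * (min ε 1 ^ 6)⁻¹ * √(2 * P.K * x) := by rw [← hmul]; ring
    _ ≤ D * (min ε 1 ^ 6)⁻¹ * (δ / D * min ε 1 ^ 6) := by gcongr
    _ = δ := by field_simp

lemma isBigO_calls_confidence (hD : 0 < D) (hδ : 0 < δ) {c : ℝ} (hc : 0 < c) :
    (fun ε : ℝ => (P.calls ε (P.confidence D ε δ) : ℝ)) =O[𝓝[>] 0]
      fun ε : ℝ => 1 / ε ^ (4 + c) := by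
  obtain ⟨D', -, h⟩ := P.exists_calls_le (c := c / 2) (η := c / 24) (by positivity)
    (by positivity)
  have hK := P.K_cast_pos
  set k := min 1 ((δ / D) ^ 2 / (2 * P.K)) with hk
  refine IsBigO.of_bound (D' * (2 * P.K / k) ^ (c / 24)) ?_
  filter_upwards [self_mem_nhdsWithin, Ioo_mem_nhdsGT one_pos] with ε (hε : 0 < ε) hε1
  have hm : min ε 1 = ε := min_eq_left hε1.2.le
  have hpow : (2 * P.K / P.confidence D ε δ) ^ (c / 24) =
      (2 * P.K / k) ^ (c / 24) * ε ^ (-(c / 2)) := by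
    have hexp : -(c / 2) = ((12 : ℕ) : ℝ) * -(c / 24) := by push_cast; ring
    rw [confidence, hm, ← hk, ← div_div, Real.div_rpow (by positivity) (by positivity), hexp,
      Real.rpow_mul hε.le, Real.rpow_natCast, Real.rpow_neg (by positivity), div_eq_mul_inv]
  have hεpow : ε ^ (-(c / 2)) * ε ^ (-(4 + c / 2)) = 1 / ε ^ (4 + c) := by
    rw [← Real.rpow_add hε, one_div, ← Real.rpow_neg hε.le]
    ring_nf
  have hcalls := h ε _ hε (confidence_pos hD hε hδ) (confidence_lt hε)
  rw [Real.norm_of_nonneg (Nat.cast_nonneg _), Real.norm_of_nonneg (by positivity), ← hεpow]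
  calc _ ≤ _ := hcalls
    _ = _ := by rw [hpow, hm]; ring

end Params

theorem theorem2 (P : Params) :
    -- every covered problem has exactly one value function
    (∀ (S : Type u) [MeasurableSpace S] (E : Env S P.K), E.Admissible P → ∃! V, E.IsValue P.γ V) ∧
    -- `n ε δ'` is the sample complexity, which is deterministic and independent of the problem
    ∃ n : ℝ → ℝ → ℕ,
      (∀ (S : Type u) [MeasurableSpace S] (E : Env S P.K) (V : S → ℝ) (lo : ℝ),
        E.Admissible P → E.IsValue P.γ V → E.ClipLevel P V lo →
        ∀ (s : S) (ε δ' : ℝ), 0 < ε → 0 < δ' →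
          IsProbabilityMeasure (Env.smoothCruiser P E lo δ' ε s) ∧
          (∀ᵐ o ∂(Env.smoothCruiser P E lo δ' ε s), o.2 = n ε δ') ∧
          (δ' < 2 * P.K →
            Env.smoothCruiser P E lo δ' ε s {o | ε < |o.1 - V s|} ≤
              ENNReal.ofReal (δ' * n ε δ'))) ∧
      ∃ δ' : ℝ → ℝ → ℝ,
        (∀ ε δ : ℝ, 0 < ε → 0 < δ → 0 < δ' ε δ ∧
          ∀ (S : Type u) [MeasurableSpace S] (E : Env S P.K) (V : S → ℝ) (lo : ℝ),
            E.Admissible P → E.IsValue P.γ V → E.ClipLevel P V lo →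
            ∀ s : S, Env.smoothCruiser P E lo (δ' ε δ) ε s {o | ε < |o.1 - V s|} ≤
              ENNReal.ofReal δ) ∧
        ∀ δ : ℝ, 0 < δ → ∀ c : ℝ, 0 < c →
          (fun ε : ℝ => (n ε (δ' ε δ) : ℝ)) =O[𝓝[>] 0] fun ε : ℝ => 1 / ε ^ (4 + c) := by
  refine ⟨fun S _ E h => ?_, P.calls, fun S _ E V lo h hV hlo s ε δ' hε hδ => ?_, ?_⟩
  · obtain ⟨V, hV⟩ := Env.exists_isValue h.isSmooth
    exact ⟨V, hV, fun W hW => hW.unique h.isSmooth hV⟩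
  · have := h.isSmooth.isMarkovKernel_draw
    have := E.isMarkovKernel_smoothCruiser lo δ' hε
    exact ⟨inferInstance, E.ae_smoothCruiser_calls lo δ' hε s, fun hδ' =>
      Env.smoothCruiser_error_le h.isSmooth hV hlo hδ hδ' hε s⟩
  · obtain ⟨D, hD, hcalls⟩ := P.exists_calls_le (c := 2) (η := 1 / 2) two_pos one_half_pos
    refine ⟨P.confidence D, fun ε δ hε hδ => ⟨Params.confidence_pos hD hε hδ, ?_⟩,
      fun δ hδ c hc => Params.isBigO_calls_confidence hD hδ hc⟩
    intro S _ E V lo h hV hlo s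
    exact (Env.smoothCruiser_error_le h.isSmooth hV hlo (Params.confidence_pos hD hε hδ)
      (Params.confidence_lt hε) hε s).trans
        (ENNReal.ofReal_le_ofReal (Params.confidence_mul_calls_le hD hε hδ hcalls))
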